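/- \textbf{Theorem.} There is an absolute constant $C$ such that the following holds. Let $A, B$ be finite sets, let $\Delta \ge 0$ be an integer, and let $f : A \times B \to \{0,1,\dots,\Delta\}$ be a function such that the real matrix $(f(a,b))_{a\in A,\, b\in B}$ has rank $r$. Then there is a deterministic two-party communication protocol that computes $f$ and whose length (the maximum, over all inputs $(a,b)$, of the number of bits exchanged) is at most $$C\cdot \Delta^{C\Delta}\cdot \sqrt{r}\cdot \log(\max\{r,2\}),$$ where $0^0 = 1$. In particular, for $r\ge 2$ the length is at most $\Delta^{O(\Delta)}\cdot\sqrt r\cdot\log r$. Here a deterministic protocol is a finite binary tree: each internal node is owned by Alice, who knows $a$, or Bob, who knows $b$; its owner sends one bit that depends only on the node and on the owner's input, and that bit selects the child to move to; each leaf is labelled with the output value. -/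

import Mathlib

/-- A deterministic two-party communication protocol on inputs `a : A` (Alice) and `b : B` (Bob)
with outputs in `Z`: a binary tree. At an internal node the player who owns it sends one bit,
which depends only on that player's input (and on the node, i.e. on the transcript so far); the
bit selects the subtree (`false`: first, `true`: second). A leaf carries the output, so that the
output is determined by the transcript alone. -/
inductive CommProtocol (A : Type*) (B : Type*) (Z : Type*)
  | output (z : Z) : CommProtocol A B Z
  | alice (msg : A → Bool) (p₀ p₁ : CommProtocol A B Z) : CommProtocol A B Z
  | bob (msg : B → Bool) (p₀ p₁ : CommProtocol A B Z) : CommProtocol A B Z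

namespace CommProtocol

/-- The output of the protocol on the input pair `(a, b)`. -/
def run {A B Z : Type*} : CommProtocol A B Z → A → B → Z
  | output z, _, _ => z
  | alice msg p₀ p₁, a, b => if msg a then p₁.run a b else p₀.run a b
  | bob msg p₀ p₁, a, b => if msg b then p₁.run a b else p₀.run a b

/-- The number of bits exchanged when the protocol is run on the input pair `(a, b)`. -/
def bits {A B Z : Type*} : CommProtocol A B Z → A → B → ℕ
  | output _, _, _ => 0
  | alice msg p₀ p₁, a, b => (if msg a then p₁.bits a b else p₀.bits a b) + 1
  | bob msg p₀ p₁, a, b => (if msg b then p₁.bits a b else p₀.bits a b) + 1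

/-- The length of a protocol: the maximum number of bits exchanged over all input pairs. -/
def length {A B Z : Type*} [Fintype A] [Fintype B] (p : CommProtocol A B Z) : ℕ :=
  Finset.univ.sup fun x : A × B => p.bits x.1 x.2

/-- The protocol computes `f`. -/
def Computes {A B Z : Type*} (p : CommProtocol A B Z) (f : A × B → Z) : Prop :=
  ∀ a b, p.run a b = f (a, b)

end CommProtocol

/-- The real matrix of values of `f : A × B → {0, 1, …, Δ}`. -/
def valueMatrix {A B : Type*} {Δ : ℕ} (f : A × B → Fin (Δ + 1)) : Matrix A B ℝ :=
  Matrix.of fun a b => ((f (a, b) : ℕ) : ℝ)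

/-! The engine is a large constant rectangle. By Kiefer–Wolfowitz, a matrix of rank at most `Q ^ 2`
with entries in `[0, D]` is, up to the factor `D * Q`, a matrix of inner products of vectors in a
unit ball. A random Gaussian direction turns such vectors into fractional rectangles whose mean at
an entry is an increasing function of that entry. Products of rectangles are rectangles, so a power
of this mean is again dominated by rectangles, and the power suppresses every entry below the
maximum. If the maximum is dense, this yields a large rectangle on which it prevails
(`RankLE.exists_amplified`), and low rank upgrades "almost everywhere" to "everywhere"
(`RankLE.exists_zero_rectangle`).

If neither the largest nor the smallest possible value is dense, the polynomial vanishing at all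
intermediate values gives a sparse matrix of rank at most `(k + 1) ^ Δ`, so it vanishes on a
half-by-half rectangle. There both extreme values are gone, and one recurses. The resulting constant
rectangle has density `2 ^ (-e)` with `e = O(Δ ^ 2 * log r * √k)`.

On the rows or on the columns of a constant rectangle the rank is about halved
(`RankLE.half_of_constant`). Splitting these off repeatedly cuts the input into a grid with about `2
^ e * Δ * k` indices on each side (`exists_partition`); naming the cell costs about `2 * e` bits.
Since the cost of a round scales like `√k` and the rank drops geometrically, the rounds sum to `O(Δ
^ 2 * √r * log r)`, within the stated bound. -/

open Matrix in
/-- The matrix `M`, restricted to the rectangle `X × Y`, has rank at most `k`, expressed through a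
factorization with inner dimension `k`. -/
def RankLE {A B : Type*} (M : A → B → ℝ) (X : Finset A) (Y : Finset B) (k : ℕ) : Prop :=
  ∃ (u : A → Fin k → ℝ) (v : B → Fin k → ℝ), ∀ i ∈ X, ∀ j ∈ Y, M i j = u i ⬝ᵥ v j

/-! ### Calculus of low-rank factorizations on rectangles. -/

namespace RankLE

open Matrix Module
open scoped RealInnerProductSpace

variable {A B : Type*} {M N : A → B → ℝ} {X X' : Finset A} {Y Y' : Finset B} {k l : ℕ}

theorem mono (h : RankLE M X Y k) (hX : X' ⊆ X) (hY : Y' ⊆ Y) : RankLE M X' Y' k := by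
  obtain ⟨u, v, h⟩ := h
  exact ⟨u, v, fun i hi j hj => h i (hX hi) j (hY hj)⟩

theorem congr (h : RankLE M X Y k) (e : ∀ i ∈ X, ∀ j ∈ Y, N i j = M i j) : RankLE N X Y k := by
  obtain ⟨u, v, h⟩ := h
  exact ⟨u, v, fun i hi j hj => (e i hi j hj).trans (h i hi j hj)⟩

theorem transpose (h : RankLE M X Y k) : RankLE (fun j i => M i j) Y X k := by
  obtain ⟨u, v, h⟩ := h
  exact ⟨v, u, fun j hj i hi => (h i hi j hj).trans (dotProduct_comm _ _)⟩

theorem of_sum {ι : Type*} [Fintype ι] (u : A → ι → ℝ) (v : B → ι → ℝ)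
    (h : ∀ i ∈ X, ∀ j ∈ Y, M i j = ∑ t, u i t * v j t) (hk : Fintype.card ι ≤ k) :
    RankLE M X Y k := by
  classical
  let e : ι ↪ Fin k := (Fintype.equivFin ι).toEmbedding.trans (Fin.castLEEmb hk)
  refine ⟨fun i => Function.extend e (u i) 0, fun j => Function.extend e (v j) 0, ?_⟩
  intro i hi j hj
  rw [h i hi j hj, dotProduct]
  rw [← Finset.sum_subset (Finset.subset_univ (Finset.univ.map e))]
  · rw [Finset.sum_map]
    refine Finset.sum_congr rfl fun t _ => ?_
    simp only [e.injective.extend_apply]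
  · intro t _ ht
    have : ¬ ∃ s, e s = t := fun ⟨s, hs⟩ => ht (by simp [← hs])
    simp only [Function.extend_apply' _ _ _ this, Pi.zero_apply, mul_zero]

theorem of_le (h : RankLE M X Y k) (hkl : k ≤ l) : RankLE M X Y l := by
  obtain ⟨u, v, h⟩ := h
  exact of_sum u v h (by simpa using hkl)

theorem of_inner {E : Type*} [NormedAddCommGroup E] [InnerProductSpace ℝ E]
    [FiniteDimensional ℝ E] (u : A → E) (v : B → E)
    (h : ∀ i ∈ X, ∀ j ∈ Y, M i j = ⟪u i, v j⟫) (hk : finrank ℝ E ≤ k) : RankLE M X Y k := by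
  let b := stdOrthonormalBasis ℝ E
  refine of_sum (fun i t => ⟪u i, b t⟫) (fun j t => ⟪b t, v j⟫) ?_ (by simpa using hk)
  intro i hi j hj
  rw [h i hi j hj, b.sum_inner_mul_inner]

theorem exists_inner (h : RankLE M X Y k) :
    ∃ (u : A → EuclideanSpace ℝ (Fin k)) (v : B → EuclideanSpace ℝ (Fin k)),
      ∀ i ∈ X, ∀ j ∈ Y, M i j = ⟪u i, v j⟫ := by
  obtain ⟨u, v, h⟩ := h
  refine ⟨fun i => WithLp.toLp 2 (u i), fun j => WithLp.toLp 2 (v j), fun i hi j hj => ?_⟩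
  rw [h i hi j hj, EuclideanSpace.inner_eq_star_dotProduct]
  simp [dotProduct_comm]

theorem affine (h : RankLE M X Y k) (a b : ℝ) :
    RankLE (fun i j => a * M i j + b) X Y (k + 1) := by
  obtain ⟨u, v, h⟩ := h
  refine of_sum (ι := Option (Fin k)) (fun i t => t.elim b fun s => a * u i s)
    (fun j t => t.elim 1 fun s => v j s) ?_ (by simp)
  intro i hi j hj
  simp only [Fintype.sum_option, Option.elim, h i hi j hj, dotProduct, Finset.mul_sum]
  rw [add_comm]
  simp [mul_assoc]

theorem mul (h : RankLE M X Y k) (h' : RankLE N X Y l) :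
    RankLE (fun i j => M i j * N i j) X Y (k * l) := by
  obtain ⟨u, v, h⟩ := h
  obtain ⟨u', v', h'⟩ := h'
  refine of_sum (ι := Fin k × Fin l) (fun i t => u i t.1 * u' i t.2)
    (fun j t => v j t.1 * v' j t.2) ?_ (by simp)
  intro i hi j hj
  simp only [h i hi j hj, h' i hi j hj, dotProduct, Finset.sum_mul_sum, Fintype.sum_prod_type]
  exact Finset.sum_congr rfl fun _ _ => Finset.sum_congr rfl fun _ _ => by ring

/-- Each factor is an affine image, of rank at most `k + 1`, and entrywise products multiply ranks.
With `s` the intermediate values, the nonzero entries mark the extreme values. -/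
theorem prod_sub (h : RankLE M X Y k) (s : Finset ℕ) :
    RankLE (fun i j => ∏ c ∈ s, (M i j - c)) X Y ((k + 1) ^ s.card) := by
  classical
  induction s using Finset.induction_on with
  | empty =>
    refine of_sum (ι := Unit) (fun _ _ => 1) (fun _ _ => 1) (fun _ _ _ _ => by simp) (by simp)
  | insert c s hc ih =>
    rw [Finset.card_insert_of_notMem hc, pow_succ']
    refine ((h.affine 1 (-c)).mul ih).congr fun i _ j _ => ?_
    rw [Finset.prod_insert hc]
    ring

theorem of_rank [Fintype A] [Fintype B] (M : Matrix A B ℝ) (X : Finset A) (Y : Finset B) :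
    RankLE M X Y M.rank := by
  classical
  let V := Submodule.span ℝ (Set.range M.col)
  have hV : finrank ℝ V = M.rank := (rank_eq_finrank_span_cols M).symm
  let b := finBasis ℝ V
  let c : B → V := fun j => ⟨M.col j, Submodule.subset_span ⟨j, rfl⟩⟩
  refine of_sum (fun i t => (b t : A → ℝ) i) (fun j t => b.repr (c j) t) ?_ (by simp [hV])
  intro i _ j _
  have := congrArg (fun w : V => (w : A → ℝ) i) (b.sum_repr (c j))
  simp only [Submodule.coe_sum, Finset.sum_apply, Submodule.coe_smul, Pi.smul_apply,
    smul_eq_mul] at this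
  rw [show M i j = ((c j : V) : A → ℝ) i from rfl, ← this]
  exact Finset.sum_congr rfl fun _ _ => mul_comm _ _

/-- If `M` vanishes on `X' × Y'`, then the ranks on `X' × Y` and on `X × Y'` add up to at most the
rank on `X × Y`. -/
theorem split_of_zero (h : RankLE M X Y k) (hX : X' ⊆ X) (hY : Y' ⊆ Y)
    (h0 : ∀ i ∈ X', ∀ j ∈ Y', M i j = 0) :
    ∃ k₁ k₂, k₁ + k₂ ≤ k ∧ RankLE M X' Y k₁ ∧ RankLE M X Y' k₂ := by
  obtain ⟨u, v, h⟩ := h.exists_inner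
  -- The zero block forces `v j ∈ Vᗮ` for `j ∈ Y'`. Projecting to `V` preserves the products on `X'
  -- × Y`, projecting to `Vᗮ` those on `X × Y'`, and the two dimensions add up to `k`.
  let V := Submodule.span ℝ (u '' X')
  have hu : ∀ i ∈ X', u i ∈ V := fun i hi => Submodule.subset_span ⟨i, hi, rfl⟩
  have hv : ∀ j ∈ Y', v j ∈ Vᗮ := by
    intro j hj
    rw [Submodule.mem_orthogonal]
    intro x hx
    induction hx using Submodule.span_induction with
    | mem x hx =>
      obtain ⟨i, hi, rfl⟩ := hx
      rw [← h i (hX hi) j (hY hj), h0 i hi j hj]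
    | zero => simp
    | add x y _ _ hx hy => rw [inner_add_left, hx, hy, add_zero]
    | smul a x _ hx => rw [inner_smul_left, hx, mul_zero]
  refine ⟨finrank ℝ V, finrank ℝ Vᗮ, ?_, ?_, ?_⟩
  · rw [V.finrank_add_finrank_orthogonal]
    simp
  · refine of_inner (fun i => V.orthogonalProjectionOnto (u i))
      (fun j => V.orthogonalProjectionOnto (v j)) ?_ le_rfl
    intro i hi j hj
    rw [h i (hX hi) j hj, Submodule.inner_orthogonalProjectionOnto_eq_of_mem_left]
    rw [V.orthogonalProjectionOnto_mem_subspace_eq_self ⟨u i, hu i hi⟩]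
  · refine of_inner (fun i => Vᗮ.orthogonalProjectionOnto (u i))
      (fun j => Vᗮ.orthogonalProjectionOnto (v j)) ?_ le_rfl
    intro i hi j hj
    rw [h i hi j (hY hj), Submodule.inner_orthogonalProjectionOnto_eq_of_mem_right]
    rw [Vᗮ.orthogonalProjectionOnto_mem_subspace_eq_self ⟨v j, hv j hj⟩]

/-- Every row is a combination of at most `k` rows. -/
theorem exists_rows (h : RankLE M X Y k) :
    ∃ I ⊆ X, I.card ≤ k ∧ ∀ i ∈ X, ∃ c : A → ℝ, ∀ j ∈ Y, M i j = ∑ t ∈ I, c t * M t j := by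
  classical
  obtain ⟨u, v, h⟩ := h
  obtain ⟨t, hts, htc, hspan, -⟩ :=
    Submodule.exists_finset_span_eq_linearIndepOn ℝ (u '' (X : Set A))
  have : ∀ x ∈ t, ∃ i ∈ X, u i = x := fun x hx => by simpa using hts hx
  choose g hgX hg using this
  have hsub : t.attach.image (fun x => g x.1 x.2) ⊆ X := by
    intro i hi
    obtain ⟨x, -, rfl⟩ := Finset.mem_image.1 hi
    exact hgX x.1 x.2
  refine ⟨t.attach.image fun x => g x.1 x.2, hsub, ?_, ?_⟩
  · refine Finset.card_image_le.trans (t.card_attach.le.trans (htc.le.trans ?_))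
    exact (Submodule.finrank_le _).trans (by simp)
  · intro i hi
    have hmem : u i ∈ Submodule.span ℝ (u '' (t.attach.image fun x => g x.1 x.2 : Finset A)) := by
      have hi' : u i ∈ Submodule.span ℝ (t : Set (Fin k → ℝ)) :=
        hspan ▸ Submodule.subset_span ⟨i, hi, rfl⟩
      refine Submodule.span_mono (fun x hx => ?_) hi'
      exact ⟨g x hx, Finset.mem_coe.2
        (Finset.mem_image.2 ⟨⟨x, hx⟩, Finset.mem_attach _ _, rfl⟩), hg x hx⟩
    obtain ⟨c, hc⟩ := Submodule.mem_span_image_finset_iff_exists_fun ℝ |>.1 hmem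
    refine ⟨fun a => if ha : a ∈ t.attach.image fun x => g x.1 x.2 then c ⟨a, ha⟩ else 0,
      fun j hj => ?_⟩
    rw [h i hi j hj, ← hc, sum_dotProduct]
    refine Eq.trans ?_ (Finset.sum_coe_sort _ _)
    refine Finset.sum_congr rfl fun i' _ => ?_
    rw [smul_dotProduct, h i' (hsub i'.2) j hj, smul_eq_mul]
    dsimp only
    rw [dif_pos i'.2]

end RankLE

/-! ### Optimal designs by maximizing a determinant. -/

section OptimalDesign

open Matrix Module
open scoped RealInnerProductSpace

/-- The second-moment matrix of the vectors `u i` with weights `c i`. -/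
def secondMoment {ι : Type*} [Fintype ι] {k : ℕ} (u : ι → Fin k → ℝ) (c : ι → ℝ) :
    Matrix (Fin k) (Fin k) ℝ :=
  ∑ i, c i • vecMulVec (u i) (u i)

variable {ι : Type*} [Fintype ι] {k : ℕ} (u : ι → Fin k → ℝ) (c : ι → ℝ)

theorem secondMoment_mulVec (x : Fin k → ℝ) :
    secondMoment u c *ᵥ x = ∑ i, (c i * (u i ⬝ᵥ x)) • u i := by
  rw [secondMoment, sum_mulVec]
  refine Finset.sum_congr rfl fun i _ => ?_
  rw [smul_mulVec, vecMulVec_mulVec, mul_smul]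
  simp

theorem dotProduct_secondMoment_mulVec (x : Fin k → ℝ) :
    x ⬝ᵥ (secondMoment u c *ᵥ x) = ∑ i, c i * (u i ⬝ᵥ x) ^ 2 := by
  rw [secondMoment_mulVec, dotProduct_sum]
  refine Finset.sum_congr rfl fun i _ => ?_
  rw [dotProduct_smul, dotProduct_comm x, smul_eq_mul]
  ring

theorem secondMoment_posSemidef (hc : ∀ i, 0 ≤ c i) : (secondMoment u c).PosSemidef := by
  refine .of_dotProduct_mulVec_nonneg ?_ fun x => ?_
  · rw [IsHermitian, secondMoment, conjTranspose_sum]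
    refine Finset.sum_congr rfl fun i _ => ?_
    rw [conjTranspose_smul, conjTranspose_vecMulVec]
    simp
  · rw [star_trivial, dotProduct_secondMoment_mulVec]
    exact Finset.sum_nonneg fun i _ => mul_nonneg (hc i) (sq_nonneg _)

theorem secondMoment_det_pos (hc : ∀ i, 0 < c i)
    (hu : Submodule.span ℝ (Set.range u) = ⊤) : 0 < (secondMoment u c).det := by
  refine PosDef.det_pos (.of_dotProduct_mulVec_pos
    (secondMoment_posSemidef u c fun i => (hc i).le).1 fun x hx => ?_)
  rw [star_trivial, dotProduct_secondMoment_mulVec]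
  refine (Finset.sum_nonneg fun i _ => mul_nonneg (hc i).le (sq_nonneg _)).lt_of_ne' fun h0 => hx ?_
  rw [Finset.sum_eq_zero_iff_of_nonneg fun i _ => mul_nonneg (hc i).le (sq_nonneg _)] at h0
  have key : ∀ y ∈ Submodule.span ℝ (Set.range u), y ⬝ᵥ x = 0 := by
    intro y hy
    induction hy using Submodule.span_induction with
    | mem y hy =>
      obtain ⟨i, rfl⟩ := hy
      simpa [(hc i).ne'] using h0 i (Finset.mem_univ i)
    | zero => simp
    | add y z _ _ hy hz => rw [add_dotProduct, hy, hz, add_zero]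
    | smul a y _ hy => rw [smul_dotProduct, hy, smul_zero]
  exact dotProduct_self_eq_zero.1 (key x (hu ▸ Submodule.mem_top))

/-- This compares derivatives at `t = 0`, done by hand: multiply by `(1 - t) ^ k`, which is at least
`1 - k * t` by Bernoulli, and use `(1 + t) ^ k * (1 - t) ^ k ≤ 1`. -/
theorem le_of_one_add_mul_le_pow {q : ℝ} (h : ∀ t : ℝ, 0 ≤ t → 1 + t * q ≤ (1 + t) ^ k) :
    q ≤ k := by
  rcases Nat.eq_zero_or_pos k with rfl | hk
  · simpa using h 1 zero_le_one
  by_contra! hq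
  have hk1 : (1 : ℝ) ≤ k := by exact_mod_cast hk
  have hq0 : 0 < q := by linarith
  -- Chosen so that the second-order term `t * k * q` is exactly half of the gap `q - k`.
  set t : ℝ := (q - k) / (2 * q * k) with ht
  have htpos : 0 < t := div_pos (by linarith) (by positivity)
  have htk : t * k * (2 * q) = q - k := by rw [ht]; field_simp
  have htk1 : t * k < 1 := by
    by_contra! hcon
    nlinarith
  have ht1 : t < 1 := lt_of_le_of_lt (le_mul_of_one_le_right htpos.le hk1) htk1
  have hb : 1 - k * t ≤ (1 - t) ^ k := by
    have := one_add_mul_le_pow (a := -t) (by linarith) k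
    simpa [sub_eq_add_neg] using this
  have hprod : (1 + t) ^ k * (1 - t) ^ k ≤ 1 := by
    rw [← mul_pow]
    exact pow_le_one₀ (by nlinarith) (by nlinarith)
  have h1 : (1 + t * q) * (1 - k * t) ≤ 1 :=
    (mul_le_mul (h t htpos.le) hb (by nlinarith) (by positivity)).trans hprod
  have h2 : t * (q - k - t * k * q) ≤ 0 := by nlinarith
  have h3 : q - k - t * k * q = (q - k) / 2 := by linarith
  rw [h3] at h2
  nlinarith [mul_pos htpos (sub_pos.2 hq)]

/-- Kiefer–Wolfowitz: spanning vectors `u i` have a design `c` whose second moment matrix is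
positive definite and bounds all `u i` by the dimension. -/
theorem exists_optimal_design [Nonempty ι] (hu : Submodule.span ℝ (Set.range u) = ⊤) :
    ∃ c ∈ stdSimplex ℝ ι, (secondMoment u c).PosDef ∧
      ∀ i, u i ⬝ᵥ ((secondMoment u c)⁻¹ *ᵥ u i) ≤ k := by
  classical
  have hcont : Continuous fun c : ι → ℝ => (secondMoment u c).det := by
    refine Continuous.matrix_det ?_
    unfold secondMoment
    fun_prop
  obtain ⟨c, hc, hmax⟩ := (isCompact_stdSimplex ℝ ι).exists_isMaxOn
    ⟨_, single_mem_stdSimplex ℝ (Classical.arbitrary ι)⟩ hcont.continuousOn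
  have hcard : (0 : ℝ) < Fintype.card ι := by exact_mod_cast Fintype.card_pos
  have hdet : 0 < (secondMoment u c).det := by
    have hmem : (fun _ : ι => (Fintype.card ι : ℝ)⁻¹) ∈ stdSimplex ℝ ι :=
      ⟨fun _ => by positivity, by simp [hcard.ne']⟩
    exact (secondMoment_det_pos u _ (fun _ => by positivity) hu).trans_le (hmax hmem)
  have hpos : (secondMoment u c).PosDef :=
    (secondMoment_posSemidef u c hc.1).posDef_iff_isUnit.2
      ((isUnit_iff_isUnit_det _).2 hdet.ne'.isUnit)
  refine ⟨c, hc, hpos, fun i => le_of_one_add_mul_le_pow fun t ht => ?_⟩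
  have ht1 : 0 < 1 + t := by linarith
  -- Move the maximizer towards the vertex `i`. By the matrix determinant lemma the determinant is
  -- multiplied by `(1 + t * q) / (1 + t) ^ k`, where `q` is the quadratic form to be bounded, and
  -- maximality makes this factor at most `1`.
  have hmem : (1 + t)⁻¹ • c + (t * (1 + t)⁻¹) • Pi.single i (1 : ℝ) ∈ stdSimplex ℝ ι :=
    convex_stdSimplex ℝ ι hc (single_mem_stdSimplex ℝ i) (by positivity) (by positivity)
      (by field_simp)
  have heq : secondMoment u ((1 + t)⁻¹ • c + (t * (1 + t)⁻¹) • Pi.single i (1 : ℝ)) =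
      (1 + t)⁻¹ • (secondMoment u c +
        replicateCol Unit (t • u i) * replicateRow Unit (u i)) := by
    have : replicateCol Unit (t • u i) * replicateRow Unit (u i) = t • vecMulVec (u i) (u i) := by
      ext a b
      simp [mul_apply, vecMulVec_apply, mul_assoc]
    rw [this]
    simp only [secondMoment, Pi.add_apply, Pi.smul_apply, smul_eq_mul, add_smul,
      Finset.sum_add_distrib, smul_add, Finset.smul_sum, mul_smul]
    congr 1
    rw [Finset.sum_eq_single i (fun j _ hj => by simp [hj]) (by simp)]
    simp only [Pi.single_eq_same, one_smul]
    rw [smul_comm]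
  have hle := hmax hmem
  change (secondMoment u _).det ≤ _ at hle
  rw [heq, det_smul, det_add_replicateCol_mul_replicateRow hdet.ne'.isUnit, Fintype.card_fin] at hle
  have hq : (1 + replicateRow Unit (u i) * (secondMoment u c)⁻¹ *
      replicateCol Unit (t • u i)).det = 1 + t * (u i ⬝ᵥ ((secondMoment u c)⁻¹ *ᵥ u i)) := by
    rw [det_unique, Matrix.add_apply, one_apply_eq, Matrix.mul_assoc, ← replicateCol_mulVec,
      mulVec_smul, mul_apply']
    congr 1
    change u i ⬝ᵥ (t • _) = _
    rw [dotProduct_smul, smul_eq_mul]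
  rw [hq, inv_pow, inv_mul_le_iff₀ (by positivity), mul_comm ((1 + t) ^ k)] at hle
  exact le_of_mul_le_mul_left hle hdet

open scoped MatrixOrder Matrix.Norms.L2Operator in
theorem Matrix.PosSemidef.exists_eq_transpose_mul {k : ℕ} {S : Matrix (Fin k) (Fin k) ℝ}
    (hS : S.PosSemidef) : ∃ T : Matrix (Fin k) (Fin k) ℝ, S = Tᵀ * T := by
  obtain ⟨T, hT⟩ := CStarAlgebra.nonneg_iff_eq_star_mul_self.1 hS.nonneg
  exact ⟨T, by simpa [star_eq_conjTranspose] using hT⟩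

end OptimalDesign

/-! ### Normalized factorizations of bounded low-rank matrices. -/

namespace RankLE

open Matrix Module
open scoped RealInnerProductSpace

variable {A B : Type*} {M : A → B → ℝ} {X : Finset A} {Y : Finset B} {r : ℕ}

/-- Take the least possible inner dimension: if the row vectors spanned a proper subspace,
coordinates in that subspace would give a smaller factorization. -/
theorem exists_spanning (h : RankLE M X Y r) :
    ∃ k ≤ r, ∃ (u : A → Fin k → ℝ) (v : B → Fin k → ℝ),
      (∀ i ∈ X, ∀ j ∈ Y, M i j = u i ⬝ᵥ v j) ∧
        Submodule.span ℝ (Set.range fun i : X => u i) = ⊤ := by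
  classical
  have hex : ∃ k, RankLE M X Y k := ⟨r, h⟩
  obtain ⟨u, v, huv⟩ := Nat.find_spec hex
  refine ⟨_, Nat.find_min' hex h, u, v, huv, ?_⟩
  refine Submodule.eq_top_of_finrank_eq (le_antisymm (Submodule.finrank_le _) ?_)
  rw [finrank_fin_fun]
  refine Nat.find_min' hex ?_
  set V := Submodule.span ℝ (Set.range fun i : X => u i) with hV
  let b := finBasis ℝ V
  have hu : ∀ i ∈ X, u i ∈ V := fun i hi => Submodule.subset_span ⟨⟨i, hi⟩, rfl⟩
  refine of_sum (fun i t => if hi : i ∈ X then b.repr ⟨u i, hu i hi⟩ t else 0)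
    (fun j t => (b t : Fin _ → ℝ) ⬝ᵥ v j) ?_ (by simp)
  intro i hi j hj
  have := congrArg (fun w : V => (w : Fin _ → ℝ) ⬝ᵥ v j) (b.sum_repr ⟨u i, hu i hi⟩)
  simp only [Submodule.coe_sum, Submodule.coe_smul, sum_dotProduct, smul_dotProduct,
    smul_eq_mul] at this
  rw [huv i hi j hj, ← this]
  simp [hi]

/-- A matrix of rank at most `r ≤ Q ^ 2` with entries bounded by `D` is, up to the factor `D * Q`,
a matrix of inner products of vectors in a unit ball. -/
theorem exists_unit_ball_vectors (h : RankLE M X Y r) {D Q : ℝ} (hD : 0 < D) (hQ : 0 < Q)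
    (hr : (r : ℝ) ≤ Q ^ 2) (hM : ∀ i ∈ X, ∀ j ∈ Y, |M i j| ≤ D) :
    ∃ (k : ℕ) (u : A → EuclideanSpace ℝ (Fin k)) (v : B → EuclideanSpace ℝ (Fin k)),
      (∀ i ∈ X, ‖u i‖ ≤ 1) ∧ (∀ j ∈ Y, ‖v j‖ ≤ 1) ∧
        ∀ i ∈ X, ∀ j ∈ Y, ⟪u i, v j⟫ = M i j / (D * Q) := by
  classical
  rcases X.eq_empty_or_nonempty with rfl | hX
  · exact ⟨0, 0, 0, by simp, by simp, by simp⟩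
  obtain ⟨k, hk, u, v, huv, hspan⟩ := h.exists_spanning
  have : Nonempty X := hX.to_subtype
  obtain ⟨c, hc, hpos, hq⟩ := exists_optimal_design (fun i : X => u i) hspan
  set S := secondMoment (fun i : X => u i) c with hS
  have hdet : IsUnit S.det := hpos.det_pos.ne'.isUnit
  obtain ⟨T, hT⟩ := hpos.posSemidef.exists_eq_transpose_mul
  have hTT : ∀ x y : Fin k → ℝ, (T *ᵥ x) ⬝ᵥ (T *ᵥ y) = x ⬝ᵥ (S *ᵥ y) := by
    intro x y
    rw [hT, ← mulVec_mulVec, dotProduct_mulVec x, vecMul_transpose]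
  have hSw : ∀ x, S *ᵥ (S⁻¹ *ᵥ x) = x := fun x => by
    rw [mulVec_mulVec, mul_nonsing_inv _ hdet, one_mulVec]
  have hinner : ∀ x y : Fin k → ℝ, ⟪WithLp.toLp 2 x, WithLp.toLp 2 y⟫ = x ⬝ᵥ y := by
    intro x y
    rw [EuclideanSpace.inner_eq_star_dotProduct]
    simp [dotProduct_comm]
  have hnorm : ∀ (x : Fin k → ℝ) (a : ℝ), 0 < a → x ⬝ᵥ x ≤ a ^ 2 →
      ‖a⁻¹ • WithLp.toLp 2 x‖ ≤ 1 := by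
    intro x a ha hx
    rw [← hinner, real_inner_self_eq_norm_sq] at hx
    rw [norm_smul, Real.norm_of_nonneg (by positivity), inv_mul_le_iff₀ ha, mul_one]
    exact le_of_sq_le_sq hx ha.le
  -- With `S = Tᵀ * T`, the unscaled squared norms are `u i ⬝ᵥ S⁻¹ *ᵥ u i ≤ k ≤ Q ^ 2` by the
  -- design, and `v j ⬝ᵥ S *ᵥ v j`, which is the `c`-average of the squared entries in column `j`.
  refine ⟨k, fun i => Q⁻¹ • WithLp.toLp 2 (T *ᵥ (S⁻¹ *ᵥ u i)),
    fun j => D⁻¹ • WithLp.toLp 2 (T *ᵥ v j), ?_, ?_, ?_⟩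
  · intro i hi
    refine hnorm _ _ hQ ?_
    rw [hTT, hSw, dotProduct_comm]
    exact (hq ⟨i, hi⟩).trans (le_trans (by exact_mod_cast hk) hr)
  · intro j hj
    refine hnorm _ _ hD ?_
    rw [hTT, dotProduct_secondMoment_mulVec]
    calc ∑ i : X, c i * (u i ⬝ᵥ v j) ^ 2 ≤ ∑ i : X, c i * D ^ 2 := by
          refine Finset.sum_le_sum fun i _ => mul_le_mul_of_nonneg_left ?_ (hc.1 i)
          rw [← huv i i.2 j hj]
          exact sq_le_sq' (abs_le.1 (hM i i.2 j hj)).1 (abs_le.1 (hM i i.2 j hj)).2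
      _ = D ^ 2 := by rw [← Finset.sum_mul, hc.2, one_mul]
  · intro i hi j hj
    rw [inner_smul_left, inner_smul_right, hinner, dotProduct_comm, hTT, hSw,
      dotProduct_comm, ← huv i hi j hj]
    simp only [conj_trivial]
    field_simp

end RankLE

/-! ### Gaussian rounding of vectors to weights. -/

section GaussianRounding

open MeasureTheory ProbabilityTheory Real
open scoped RealInnerProductSpace

variable {E : Type*} [NormedAddCommGroup E] [InnerProductSpace ℝ E]

/-- The weight in `[0, 1]` that the direction `g` assigns to a vector `u` of the unit ball. -/
noncomputable def roundingWeight (u g : E) : ℝ :=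
  (1 + exp ((‖u‖ ^ 2 - 1) / 2) * sin ⟪g, u⟫) / 2

theorem roundingWeight_mem_Icc {u : E} (hu : ‖u‖ ≤ 1) (g : E) :
    roundingWeight u g ∈ Set.Icc (0 : ℝ) 1 := by
  have h1 : exp ((‖u‖ ^ 2 - 1) / 2) ≤ 1 := exp_le_one_iff.2 (by nlinarith [norm_nonneg u])
  have h2 : |exp ((‖u‖ ^ 2 - 1) / 2) * sin ⟪g, u⟫| ≤ 1 := by
    rw [abs_mul, abs_exp]
    exact mul_le_one₀ h1 (abs_nonneg _) (abs_sin_le_one _)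
  rw [abs_le] at h2
  constructor <;> unfold roundingWeight <;> linarith

variable [FiniteDimensional ℝ E] [MeasurableSpace E] [BorelSpace E]

theorem integral_cos_inner_stdGaussian (t : E) :
    ∫ g, cos ⟪g, t⟫ ∂(stdGaussian E) = exp (-‖t‖ ^ 2 / 2) := by
  have h := congrArg Complex.re (charFun_stdGaussian t)
  rw [charFun_apply] at h
  have hint : Integrable (fun g : E => Complex.exp (⟪g, t⟫ * Complex.I)) (stdGaussian E) :=
    (integrable_const (1 : ℝ)).mono' (by fun_prop)
      (.of_forall fun g => by simp [Complex.norm_exp_ofReal_mul_I])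
  have h2 := integral_re hint
  simp only [RCLike.re_to_complex, Complex.exp_ofReal_mul_I_re] at h2
  rw [h2, h, show (-(‖t‖ : ℂ) ^ 2 / 2) = ((-‖t‖ ^ 2 / 2 : ℝ) : ℂ) by push_cast; ring,
    Complex.exp_ofReal_re]

theorem integral_sin_inner_stdGaussian (t : E) :
    ∫ g, sin ⟪g, t⟫ ∂(stdGaussian E) = 0 := by
  have h := congrArg Complex.im (charFun_stdGaussian t)
  rw [charFun_apply] at h
  have hint : Integrable (fun g : E => Complex.exp (⟪g, t⟫ * Complex.I)) (stdGaussian E) :=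
    (integrable_const (1 : ℝ)).mono' (by fun_prop)
      (.of_forall fun g => by simp [Complex.norm_exp_ofReal_mul_I])
  have h2 := integral_im hint
  simp only [RCLike.im_to_complex, Complex.exp_ofReal_mul_I_im] at h2
  rw [h2, h, show (-(‖t‖ : ℂ) ^ 2 / 2) = ((-‖t‖ ^ 2 / 2 : ℝ) : ℂ) by push_cast; ring,
    Complex.exp_ofReal_im]

theorem integrable_sin_inner (t : E) :
    Integrable (fun g : E => sin ⟪g, t⟫) (stdGaussian E) :=
  (integrable_const (1 : ℝ)).mono' (by fun_prop) (.of_forall fun g => abs_sin_le_one _)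

theorem integrable_cos_inner (t : E) :
    Integrable (fun g : E => cos ⟪g, t⟫) (stdGaussian E) :=
  (integrable_const (1 : ℝ)).mono' (by fun_prop) (.of_forall fun g => abs_cos_le_one _)

/-- The sine terms average to zero, and the product of sines is half the difference of the cosines
at `u - v` and `u + v`, whose means are values of the Gaussian characteristic function. -/
theorem hasIntegral_roundingWeight_mul (u v : E) :
    Integrable (fun g => roundingWeight u g * roundingWeight v g) (stdGaussian E) ∧
      ∫ g, roundingWeight u g * roundingWeight v g ∂(stdGaussian E) =
        (1 + exp (-1) * sinh ⟪u, v⟫) / 4 := by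
  set a := exp ((‖u‖ ^ 2 - 1) / 2) with ha
  set b := exp ((‖v‖ ^ 2 - 1) / 2) with hb
  have hexp : (fun g => roundingWeight u g * roundingWeight v g) = fun g =>
      1 / 4 + a / 4 * sin ⟪g, u⟫ + b / 4 * sin ⟪g, v⟫ + a * b / 8 * cos ⟪g, u - v⟫
        - a * b / 8 * cos ⟪g, u + v⟫ := by
    funext g
    rw [inner_sub_right, inner_add_right, cos_sub, cos_add]
    unfold roundingWeight
    ring
  have i1 : Integrable (fun _ : E => (1 / 4 : ℝ)) (stdGaussian E) := integrable_const _
  have i2 := (integrable_sin_inner u).const_mul (a / 4)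
  have i3 := (integrable_sin_inner v).const_mul (b / 4)
  have i4 := (integrable_cos_inner (u - v)).const_mul (a * b / 8)
  have i5 := (integrable_cos_inner (u + v)).const_mul (a * b / 8)
  rw [hexp]
  have j2 : Integrable (fun g : E => 1 / 4 + a / 4 * sin ⟪g, u⟫) (stdGaussian E) := i1.add i2
  have j3 : Integrable (fun g : E => 1 / 4 + a / 4 * sin ⟪g, u⟫ + b / 4 * sin ⟪g, v⟫)
    (stdGaussian E) := j2.add i3
  have j4 : Integrable (fun g : E => 1 / 4 + a / 4 * sin ⟪g, u⟫ + b / 4 * sin ⟪g, v⟫ +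
    a * b / 8 * cos ⟪g, u - v⟫) (stdGaussian E) := j3.add i4
  refine ⟨j4.sub i5, ?_⟩
  rw [integral_sub j4 i5, integral_add j3 i4, integral_add j2 i3, integral_add i1 i2]
  simp only [integral_const_mul, integral_sin_inner_stdGaussian, integral_cos_inner_stdGaussian,
    integral_const, probReal_univ, smul_eq_mul]
  -- The damping factors cancel the norms, so only the inner product survives.
  have e1 : a * b * exp (-‖u - v‖ ^ 2 / 2) = exp (-1) * exp ⟪u, v⟫ := by
    rw [ha, hb, ← exp_add, ← exp_add, ← exp_add, norm_sub_sq_real]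
    ring_nf
  have e2 : a * b * exp (-‖u + v‖ ^ 2 / 2) = exp (-1) * exp (-⟪u, v⟫) := by
    rw [ha, hb, ← exp_add, ← exp_add, ← exp_add, norm_add_sq_real]
    ring_nf
  rw [sinh_eq]
  linear_combination (1 / 8 : ℝ) * e1 - (1 / 8 : ℝ) * e2

end GaussianRounding

/-! ### Mixtures of rectangles, in dual form. -/

/-- Every linear functional takes, at some fractional rectangle `x ⊗ y` on `X × Y`, a value at
least as large as at `p`; that is, `p` is dominated by mixtures of rectangles. -/
def IsRectangleMixture {A B : Type*} (X : Finset A) (Y : Finset B) (p : A → B → ℝ) : Prop :=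
  ∀ W : A → B → ℝ, ∃ (x : A → ℝ) (y : B → ℝ),
    (∀ i ∈ X, x i ∈ Set.Icc (0 : ℝ) 1) ∧ (∀ j ∈ Y, y j ∈ Set.Icc (0 : ℝ) 1) ∧
      ∑ i ∈ X, ∑ j ∈ Y, W i j * p i j ≤ ∑ i ∈ X, ∑ j ∈ Y, W i j * (x i * y j)

namespace IsRectangleMixture

variable {A B : Type*} {X : Finset A} {Y : Finset B} {p q : A → B → ℝ}

theorem one : IsRectangleMixture X Y (fun _ _ => 1) := fun _ =>
  ⟨fun _ => 1, fun _ => 1, by simp, by simp, by simp⟩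

/-- The dual form replaces products of independent random rectangles: `p` is tested against `W * q`,
then `q` against `W` reweighted by the rectangle just found. -/
theorem mul (hp : IsRectangleMixture X Y p) (hq : IsRectangleMixture X Y q) :
    IsRectangleMixture X Y (fun i j => p i j * q i j) := by
  intro W
  obtain ⟨x, y, hx, hy, h⟩ := hp fun i j => W i j * q i j
  obtain ⟨x', y', hx', hy', h'⟩ := hq fun i j => W i j * (x i * y j)
  refine ⟨fun i => x i * x' i, fun j => y j * y' j, ?_, ?_, ?_⟩
  · exact fun i hi => ⟨mul_nonneg (hx i hi).1 (hx' i hi).1,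
      mul_le_one₀ (hx i hi).2 (hx' i hi).1 (hx' i hi).2⟩
  · exact fun i hi => ⟨mul_nonneg (hy i hi).1 (hy' i hi).1,
      mul_le_one₀ (hy i hi).2 (hy' i hi).1 (hy' i hi).2⟩
  · calc ∑ i ∈ X, ∑ j ∈ Y, W i j * (p i j * q i j)
        = ∑ i ∈ X, ∑ j ∈ Y, W i j * q i j * p i j :=
          Finset.sum_congr rfl fun _ _ => Finset.sum_congr rfl fun _ _ => by ring
      _ ≤ ∑ i ∈ X, ∑ j ∈ Y, W i j * q i j * (x i * y j) := h
      _ = ∑ i ∈ X, ∑ j ∈ Y, W i j * (x i * y j) * q i j :=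
          Finset.sum_congr rfl fun _ _ => Finset.sum_congr rfl fun _ _ => by ring
      _ ≤ _ := h'
      _ = _ := Finset.sum_congr rfl fun _ _ => Finset.sum_congr rfl fun _ _ => by ring

theorem pow (hp : IsRectangleMixture X Y p) (n : ℕ) :
    IsRectangleMixture X Y (fun i j => p i j ^ n) := by
  induction n with
  | zero => simpa using one
  | succ n ih => simpa only [pow_succ] using ih.mul hp

theorem sum_mul_le_sum_filter {ι : Type*} (s : Finset ι) (w x : ι → ℝ)
    (hx : ∀ i ∈ s, x i ∈ Set.Icc (0 : ℝ) 1) :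
    ∑ i ∈ s, w i * x i ≤ ∑ i ∈ s with 0 < w i, w i := by
  rw [Finset.sum_filter]
  refine Finset.sum_le_sum fun i hi => ?_
  obtain ⟨h0, h1⟩ := hx i hi
  split_ifs with hw
  · exact mul_le_of_le_one_right hw.le h1
  · exact mul_nonpos_of_nonpos_of_nonneg (not_lt.1 hw) h0

/-- A bilinear form on a product of cubes is largest at vertices: keep the rows of positive weight,
then the columns of positive weight given those rows. -/
theorem exists_rectangle (hp : IsRectangleMixture X Y p) (W : A → B → ℝ) :
    ∃ X' ⊆ X, ∃ Y' ⊆ Y, ∑ i ∈ X, ∑ j ∈ Y, W i j * p i j ≤ ∑ i ∈ X', ∑ j ∈ Y', W i j := by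
  obtain ⟨x, y, hx, hy, h⟩ := hp W
  refine ⟨_, Finset.filter_subset (fun i => 0 < ∑ j ∈ Y, W i j * y j) X,
    _, Finset.filter_subset (fun j => 0 < ∑ i ∈ X with 0 < ∑ j ∈ Y, W i j * y j, W i j) Y, ?_⟩
  calc _ ≤ _ := h
    _ = ∑ i ∈ X, (∑ j ∈ Y, W i j * y j) * x i := by
      refine Finset.sum_congr rfl fun i _ => ?_
      rw [Finset.sum_mul]
      exact Finset.sum_congr rfl fun _ _ => by ring
    _ ≤ _ := sum_mul_le_sum_filter X _ x hx
    _ = ∑ j ∈ Y, (∑ i ∈ X with 0 < ∑ j ∈ Y, W i j * y j, W i j) * y j := by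
      rw [Finset.sum_comm]
      exact Finset.sum_congr rfl fun _ _ => by rw [Finset.sum_mul]
    _ ≤ _ := sum_mul_le_sum_filter Y _ y hy
    _ = _ := Finset.sum_comm

open MeasureTheory ProbabilityTheory Real in
open scoped RealInnerProductSpace in
theorem of_inner {k : ℕ} {u : A → EuclideanSpace ℝ (Fin k)} {v : B → EuclideanSpace ℝ (Fin k)}
    (hu : ∀ i ∈ X, ‖u i‖ ≤ 1) (hv : ∀ j ∈ Y, ‖v j‖ ≤ 1) :
    IsRectangleMixture X Y (fun i j => (1 + exp (-1) * sinh ⟪u i, v j⟫) / 4) := by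
  intro W
  let μ := stdGaussian (EuclideanSpace ℝ (Fin k))
  let F : EuclideanSpace ℝ (Fin k) → ℝ := fun g =>
    ∑ i ∈ X, ∑ j ∈ Y, W i j * (roundingWeight (u i) g * roundingWeight (v j) g)
  have hint : ∀ i j, Integrable
      (fun g => W i j * (roundingWeight (u i) g * roundingWeight (v j) g)) μ :=
    fun i j => (hasIntegral_roundingWeight_mul (u i) (v j)).1.const_mul _
  have hF : Integrable F μ :=
    integrable_finsetSum _ fun i _ => integrable_finsetSum _ fun j _ => hint i j
  obtain ⟨g, hg⟩ := exists_integral_le hF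
  refine ⟨fun i => roundingWeight (u i) g, fun j => roundingWeight (v j) g,
    fun i hi => roundingWeight_mem_Icc (hu i hi) g,
    fun j hj => roundingWeight_mem_Icc (hv j hj) g, ?_⟩
  refine le_trans (le_of_eq ?_) hg
  rw [integral_finsetSum _ fun i _ => integrable_finsetSum _ fun j _ => hint i j]
  refine Finset.sum_congr rfl fun i _ => ?_
  rw [integral_finsetSum _ fun j _ => hint i j]
  refine Finset.sum_congr rfl fun j _ => ?_
  rw [integral_const_mul, (hasIntegral_roundingWeight_mul (u i) (v j)).2]

end IsRectangleMixture

/-! ### Amplifying the largest value by powers. -/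

section Amplification

open Real

/-- As `P ≤ 1 / 2`, the gap is a relative drop of at least `exp (-1) / (2 * s)`. Raised to the power
`4 * s` it gives a factor at most `exp (-2 / e)`, and `2 / e > log 2`. -/
theorem pow_half_of_gap {s : ℕ} (hs : 0 < s) {P p : ℝ} (hp : 0 ≤ p) (hP : P ≤ 1 / 2) (hP0 : 0 ≤ P)
    (hgap : p + exp (-1) / (4 * s) ≤ P) : p ^ (4 * s) ≤ P ^ (4 * s) / 2 := by
  have hs' : (0 : ℝ) < s := by exact_mod_cast hs
  set x : ℝ := exp (-1) / (2 * s) with hx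
  have hx0 : 0 < x := by positivity
  have h1 : p ≤ P * (1 - x) := by
    have : P * x ≤ exp (-1) / (4 * s) := by
      calc P * x ≤ 1 / 2 * x := by gcongr
        _ = _ := by rw [hx]; field_simp; norm_num
    linarith
  have h2 : p ≤ P * exp (-x) := by
    refine h1.trans (mul_le_mul_of_nonneg_left ?_ hP0)
    linarith [add_one_le_exp (-x)]
  calc p ^ (4 * s) ≤ (P * exp (-x)) ^ (4 * s) := pow_le_pow_left₀ hp h2 _
    _ = P ^ (4 * s) * exp (-(2 * exp (-1))) := by
      rw [mul_pow, ← exp_nat_mul]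
      congr 2
      rw [hx]
      push_cast
      field_simp
      norm_num
    _ ≤ P ^ (4 * s) * (1 / 2) := by
      refine mul_le_mul_of_nonneg_left ?_ (by positivity)
      rw [← log_le_log_iff (exp_pos _) (by norm_num), log_exp, one_div, log_inv, neg_le_neg_iff,
        exp_neg, ← div_eq_mul_inv, le_div_iff₀ (exp_pos _)]
      have := log_two_lt_d9
      have := exp_one_lt_d9
      have := log_two_gt_d9
      nlinarith
    _ = _ := by ring

variable {A B : Type*} {N : A → B → ℝ} {X : Finset A} {Y : Finset B} {r : ℕ}

/-- If the largest value `τ` of a low-rank matrix has density at least `2 ^ (-d)`, then there is a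
large rectangle on which `τ` has density at least `1 - 2 ^ (-l)`. -/
theorem RankLE.exists_amplified (h : RankLE N X Y r) {D Q d l : ℕ} {τ : ℝ} (hD : 0 < D)
    (hQ : 0 < Q) (hr : r ≤ Q ^ 2) (hN : ∀ i ∈ X, ∀ j ∈ Y, N i j ∈ Set.Icc (0 : ℝ) D)
    (hτ : τ ∈ Set.Icc (0 : ℝ) D) (hgap : ∀ i ∈ X, ∀ j ∈ Y, N i j = τ ∨ N i j ≤ τ - 1)
    (htop : X.card * Y.card ≤ 2 ^ d * {z ∈ X ×ˢ Y | N z.1 z.2 = τ}.card) :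
    ∃ X' ⊆ X, ∃ Y' ⊆ Y,
      2 ^ l * {z ∈ X' ×ˢ Y' | N z.1 z.2 ≠ τ}.card ≤ X'.card * Y'.card ∧
      X.card * Y.card ≤ 2 ^ (8 * (D * Q) * (l + d + 1) + d + 1) * (X'.card * Y'.card) := by
  set s := D * Q with hs
  have hs0 : 0 < s := Nat.mul_pos hD hQ
  have hs0' : (0 : ℝ) < s := by exact_mod_cast hs0
  have hDs : (D : ℝ) ≤ s := by exact_mod_cast Nat.le_mul_of_pos_right D hQ
  obtain ⟨k, u, v, hu, hv, huv⟩ := h.exists_unit_ball_vectors (D := D) (Q := Q)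
    (by exact_mod_cast hD) (by exact_mod_cast hQ) (by exact_mod_cast hr)
    (fun i hi j hj => abs_le.2 ⟨by linarith [(hN i hi j hj).1, (hN i hi j hj).2],
      (hN i hi j hj).2⟩)
  set n := l + d + 1 with hn
  set φ : ℝ → ℝ := fun t => (1 + exp (-1) * sinh (t / s)) / 4 with hφ
  set P := φ τ with hP
  -- Each block of `4 * s` factors halves the lower values relative to `P`. With `n = l + d + 1`
  -- blocks, even after the penalty `2 ^ l` they weigh at most `2 ^ (-(d + 1))`, half the guaranteed
  -- density of `τ`.
  set T := 4 * s * n with hT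
  have hmix := (IsRectangleMixture.of_inner hu hv).pow T
  set W : A → B → ℝ := fun i j => if N i j = τ then 1 else -2 ^ l with hW
  obtain ⟨X', hX', Y', hY', hsum⟩ := hmix.exists_rectangle W
  have hφ0 : ∀ t, 0 ≤ t → 1 / 4 ≤ φ t := by
    intro t ht
    have : 0 ≤ sinh (t / s) := sinh_nonneg_iff.2 (by positivity)
    have : 0 ≤ exp (-1) * sinh (t / s) := by positivity
    simp only [hφ]
    linarith
  have hP4 : 1 / 4 ≤ P := hφ0 τ hτ.1
  have hP2 : P ≤ 1 / 2 := by
    have h1 : sinh (τ / s) ≤ exp 1 := by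
      calc sinh (τ / s) ≤ sinh 1 := sinh_le_sinh.2 ((div_le_one hs0').2 (hτ.2.trans hDs))
        _ ≤ exp 1 := by rw [sinh_eq]; linarith [exp_pos 1, exp_pos (-1)]
    have h2 : exp (-1) * sinh (τ / s) ≤ 1 := by
      calc exp (-1) * sinh (τ / s) ≤ exp (-1) * exp 1 := by gcongr
        _ = 1 := by rw [← exp_add]; simp
    simp only [hP, hφ]
    linarith
  have hsmall : ∀ t, 0 ≤ t → t ≤ τ - 1 → φ t ^ T ≤ P ^ T / 2 ^ n := by
    intro t ht0 ht
    have hg : φ t + exp (-1) / (4 * s) ≤ P := by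
      have hle : t / s ≤ τ / s := by gcongr; linarith
      -- `sinh` grows at least as fast as the identity, so a gap of `1` in the entries gives a gap
      -- of at least `1 / s` here.
      have hm : sinh (t / s) - t / s ≤ sinh (τ / s) - τ / s :=
        sinh_sub_id_strictMono.monotone hle
      have h1 : 1 / s ≤ sinh (τ / s) - sinh (t / s) := by
        have : (1 : ℝ) / s ≤ (τ - t) / s := by gcongr; linarith
        rw [sub_div] at this
        linarith
      have h2 := mul_le_mul_of_nonneg_left h1 (exp_pos (-1)).le
      have h3 : exp (-1) / (4 * s) = exp (-1) * (1 / s) / 4 := by field_simp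
      rw [h3]
      simp only [hP, hφ]
      linarith
    have := pow_half_of_gap hs0 (by linarith [hφ0 t ht0]) hP2 (by linarith) hg
    calc φ t ^ T = (φ t ^ (4 * s)) ^ n := by rw [hT, pow_mul]
      _ ≤ (P ^ (4 * s) / 2) ^ n :=
        pow_le_pow_left₀ (pow_nonneg (by linarith [hφ0 t ht0]) _) this _
      _ = _ := by rw [div_pow, hT, pow_mul P (4 * s)]
  have hPT : (1 / 4 : ℝ) ^ T ≤ P ^ T := pow_le_pow_left₀ (by norm_num) hP4 _
  -- the value of the functional at the mixture
  have hlow : P ^ T * ({z ∈ X ×ˢ Y | N z.1 z.2 = τ}.card - (X.card * Y.card : ℝ) / 2 ^ (d + 1)) ≤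
      ∑ i ∈ X, ∑ j ∈ Y, W i j * φ (N i j) ^ T := by
    have hcard : ((X.card : ℝ) * Y.card) = ∑ z ∈ X ×ˢ Y, (1 : ℝ) := by simp
    have hcard' : (({z ∈ X ×ˢ Y | N z.1 z.2 = τ}.card : ℕ) : ℝ) =
        ∑ z ∈ X ×ˢ Y, if N z.1 z.2 = τ then (1 : ℝ) else 0 := by simp
    rw [← Finset.sum_product', hcard, hcard', Finset.sum_div, ← Finset.sum_sub_distrib,
      Finset.mul_sum]
    refine Finset.sum_le_sum fun z hz => ?_
    obtain ⟨hi, hj⟩ := Finset.mem_product.1 hz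
    have hpos : 0 ≤ P ^ T := pow_nonneg (by linarith) _
    by_cases hz' : N z.1 z.2 = τ
    · simp only [hW, hz', if_true, one_mul]
      refine mul_le_of_le_one_right hpos ?_
      have : (0 : ℝ) < 1 / 2 ^ (d + 1) := by positivity
      linarith
    · have hle := hsmall _ (hN _ hi _ hj).1 ((hgap _ hi _ hj).resolve_left hz')
      simp only [hW, hz', if_false]
      have h2 : (2 : ℝ) ^ l * φ (N z.1 z.2) ^ T ≤ P ^ T * (1 / 2 ^ (d + 1)) := by
        calc (2 : ℝ) ^ l * φ (N z.1 z.2) ^ T ≤ 2 ^ l * (P ^ T / 2 ^ n) := by gcongr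
          _ = _ := by
            rw [hn, show l + d + 1 = l + (d + 1) by ring, pow_add 2 l]
            field_simp
      linarith
  have hup : ∑ i ∈ X', ∑ j ∈ Y', W i j = (X'.card * Y'.card : ℝ) -
      (2 ^ l + 1) * {z ∈ X' ×ˢ Y' | N z.1 z.2 ≠ τ}.card := by
    have hcard : ((X'.card : ℝ) * Y'.card) = ∑ z ∈ X' ×ˢ Y', (1 : ℝ) := by simp
    have hcard' : (({z ∈ X' ×ˢ Y' | N z.1 z.2 ≠ τ}.card : ℕ) : ℝ) =
        ∑ z ∈ X' ×ˢ Y', if N z.1 z.2 ≠ τ then (1 : ℝ) else 0 := by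
      rw [Finset.sum_boole]
    rw [← Finset.sum_product', hcard, hcard', Finset.mul_sum, ← Finset.sum_sub_distrib]
    refine Finset.sum_congr rfl fun z _ => ?_
    by_cases hz' : N z.1 z.2 = τ <;> simp [hW, hz']
  have hsum' : ∑ i ∈ X, ∑ j ∈ Y, W i j * φ (N i j) ^ T ≤ ∑ i ∈ X', ∑ j ∈ Y', W i j := by
    refine le_trans (le_of_eq ?_) hsum
    refine Finset.sum_congr rfl fun i hi => Finset.sum_congr rfl fun j hj => ?_
    simp only [hφ, huv i hi j hj, hs, Nat.cast_mul]
  have htop' : (X.card * Y.card : ℝ) / 2 ^ d ≤ {z ∈ X ×ˢ Y | N z.1 z.2 = τ}.card := by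
    rw [div_le_iff₀' (by positivity)]
    exact_mod_cast htop
  set a : ℝ := X.card * Y.card with ha
  have ha0 : 0 ≤ a := by positivity
  have hmain : (1 / 4 : ℝ) ^ T * (a / 2 ^ (d + 1)) ≤ (X'.card * Y'.card : ℝ) -
      (2 ^ l + 1) * {z ∈ X' ×ˢ Y' | N z.1 z.2 ≠ τ}.card := by
    rw [← hup]
    refine le_trans ?_ (hlow.trans hsum')
    have h3 : a / 2 ^ (d + 1) ≤
        {z ∈ X ×ˢ Y | N z.1 z.2 = τ}.card - a / 2 ^ (d + 1) := by
      have : a / 2 ^ d = a / 2 ^ (d + 1) + a / 2 ^ (d + 1) := by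
        rw [pow_succ]; field_simp; norm_num
      linarith
    exact mul_le_mul hPT h3 (by positivity) (pow_nonneg (by linarith) _)
  have hnn : (0 : ℝ) ≤ {z ∈ X' ×ˢ Y' | N z.1 z.2 ≠ τ}.card := by positivity
  refine ⟨X', hX', Y', hY', ?_, ?_⟩
  · have h0 : 0 ≤ (1 / 4 : ℝ) ^ T * (a / 2 ^ (d + 1)) := by positivity
    have : (2 : ℝ) ^ l * {z ∈ X' ×ˢ Y' | N z.1 z.2 ≠ τ}.card ≤ X'.card * Y'.card := by nlinarith
    exact_mod_cast this
  · have h1 : (1 / 4 : ℝ) ^ T * (a / 2 ^ (d + 1)) ≤ X'.card * Y'.card := by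
      have : (0 : ℝ) ≤ (2 ^ l + 1) * {z ∈ X' ×ˢ Y' | N z.1 z.2 ≠ τ}.card := by positivity
      linarith
    have h2 : (2 : ℝ) ^ (8 * s * n + d + 1) * ((1 / 4 : ℝ) ^ T * (a / 2 ^ (d + 1))) = a := by
      have : (2 : ℝ) ^ (8 * s * n + d + 1) = 4 ^ T * 2 ^ (d + 1) := by
        rw [show (4 : ℝ) = 2 ^ 2 by norm_num, ← pow_mul, ← pow_add, hT]
        congr 1
        ring
      rw [this, one_div, inv_pow]
      field_simp
    have h3 : a ≤ (2 : ℝ) ^ (8 * s * n + d + 1) * (X'.card * Y'.card) := by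
      rw [← h2]
      gcongr
    rw [ha] at h3
    exact_mod_cast h3

end Amplification

/-! ### From sparse errors to constant rectangles. -/

namespace RankLE

variable {A B : Type*} {N : A → B → ℝ} {X : Finset A} {Y : Finset B} {k r : ℕ}

/-- A sparse low-rank matrix vanishes on a rectangle with at least half of the rows and half of
the columns. -/
theorem exists_zero_rectangle (h : RankLE N X Y k) (hk : 0 < k)
    (hs : 4 * k * {z ∈ X ×ˢ Y | N z.1 z.2 ≠ 0}.card ≤ X.card * Y.card) :
    ∃ X' ⊆ X, ∃ Y' ⊆ Y, X.card ≤ 2 * X'.card ∧ Y.card ≤ 2 * Y'.card ∧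
      ∀ i ∈ X', ∀ j ∈ Y', N i j = 0 := by
  classical
  set n : A → ℕ := fun i => {j ∈ Y | N i j ≠ 0}.card with hn
  have htot : {z ∈ X ×ˢ Y | N z.1 z.2 ≠ 0}.card = ∑ i ∈ X, n i := by
    simp only [hn, Finset.card_filter, Finset.sum_product]
  set X' := {i ∈ X | 2 * k * n i ≤ Y.card} with hX'
  have hX'X : X' ⊆ X := Finset.filter_subset _ _
  have hbad : 2 * ({i ∈ X | ¬ 2 * k * n i ≤ Y.card}.card * Y.card) ≤ X.card * Y.card := by
    refine le_trans ?_ hs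
    calc 2 * ({i ∈ X | ¬ 2 * k * n i ≤ Y.card}.card * Y.card)
        = 2 * ∑ i ∈ X with ¬ 2 * k * n i ≤ Y.card, Y.card := by simp
      _ ≤ 2 * ∑ i ∈ X with ¬ 2 * k * n i ≤ Y.card, 2 * k * n i := by
        refine Nat.mul_le_mul_left _ (Finset.sum_le_sum fun i hi => ?_)
        exact (not_le.1 (Finset.mem_filter.1 hi).2).le
      _ ≤ 2 * ∑ i ∈ X, 2 * k * n i :=
        Nat.mul_le_mul_left _ (Finset.sum_le_sum_of_subset (Finset.filter_subset _ _))
      _ = _ := by rw [htot, ← Finset.mul_sum]; ring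
  have hsplit : X'.card + {i ∈ X | ¬ 2 * k * n i ≤ Y.card}.card = X.card :=
    Finset.card_filter_add_card_filter_not (s := X) (fun i => 2 * k * n i ≤ Y.card)
  have hXc : X.card ≤ 2 * X'.card := by
    rcases Nat.eq_zero_or_pos Y.card with hY | hY
    · have : X' = X := Finset.filter_true_of_mem fun i _ => by
        simp [hn, Finset.card_eq_zero.1 hY]
      rw [this]
      omega
    · have := Nat.le_of_mul_le_mul_right (by linarith : 2 * {i ∈ X | ¬ 2 * k * n i ≤ Y.card}.card *
        Y.card ≤ X.card * Y.card) hY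
      omega
  -- At most `k` sparse rows generate all sparse rows. Each has at most `|Y| / (2 * k)` nonzero
  -- entries, so at least half of the columns vanish on all generators, hence on all of `X'`.
  obtain ⟨I, hI, hIc, hrows⟩ := (h.mono hX'X subset_rfl).exists_rows
  set Y' := {j ∈ Y | ∀ i ∈ I, N i j = 0} with hY'
  refine ⟨X', hX'X, Y', Finset.filter_subset _ _, hXc, ?_, ?_⟩
  · have h1 : {j ∈ Y | ¬ ∀ i ∈ I, N i j = 0}.card ≤ ∑ i ∈ I, n i := by
      refine le_trans (Finset.card_le_card fun j hj => ?_) Finset.card_biUnion_le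
      obtain ⟨hjY, hj⟩ := Finset.mem_filter.1 hj
      push Not at hj
      obtain ⟨i, hi, hij⟩ := hj
      exact Finset.mem_biUnion.2 ⟨i, hi, Finset.mem_filter.2 ⟨hjY, hij⟩⟩
    have h2 : k * (2 * ∑ i ∈ I, n i) ≤ k * Y.card := by
      calc k * (2 * ∑ i ∈ I, n i) = ∑ i ∈ I, 2 * k * n i := by rw [← Finset.mul_sum]; ring
        _ ≤ ∑ i ∈ I, Y.card := Finset.sum_le_sum fun i hi => (Finset.mem_filter.1 (hI hi)).2
        _ = I.card * Y.card := by simp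
        _ ≤ k * Y.card := Nat.mul_le_mul_right _ hIc
    have h3 := Nat.le_of_mul_le_mul_left h2 hk
    have h4 : Y'.card + {j ∈ Y | ¬ ∀ i ∈ I, N i j = 0}.card = Y.card :=
      Finset.card_filter_add_card_filter_not (s := Y) (fun j => ∀ i ∈ I, N i j = 0)
    omega
  · intro i hi j hj
    obtain ⟨c, hc⟩ := hrows i hi
    obtain ⟨hjY, hj0⟩ := Finset.mem_filter.1 hj
    rw [hc j hjY]
    exact Finset.sum_eq_zero fun t ht => by rw [hj0 t ht, mul_zero]

/-- If the largest value `τ` of a low-rank matrix is dense, then the matrix is equal to `τ` on a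
large rectangle. -/
theorem exists_top_rectangle (h : RankLE N X Y r) {D Q d lam : ℕ} {τ : ℝ}
    (h' : RankLE (fun i j => N i j - τ) X Y r) (hD : 0 < D) (hQ : 0 < Q) (hr : r ≤ Q ^ 2)
    (hlam : r ≤ 2 ^ lam) (hN : ∀ i ∈ X, ∀ j ∈ Y, N i j ∈ Set.Icc (0 : ℝ) D)
    (hτ : τ ∈ Set.Icc (0 : ℝ) D) (hgap : ∀ i ∈ X, ∀ j ∈ Y, N i j = τ ∨ N i j ≤ τ - 1)
    (htop : X.card * Y.card ≤ 2 ^ d * {z ∈ X ×ˢ Y | N z.1 z.2 = τ}.card) :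
    ∃ X' ⊆ X, ∃ Y' ⊆ Y, (∀ i ∈ X', ∀ j ∈ Y', N i j = τ) ∧
      X.card * Y.card ≤ 2 ^ (8 * (D * Q) * (lam + d + 3) + d + 3) * (X'.card * Y'.card) := by
  obtain ⟨X₁, hX₁, Y₁, hY₁, hsp, hcard⟩ :=
    h.exists_amplified (l := lam + 2) hD hQ hr hN hτ hgap htop
  have hset : {z ∈ X₁ ×ˢ Y₁ | N z.1 z.2 - τ ≠ 0} = {z ∈ X₁ ×ˢ Y₁ | N z.1 z.2 ≠ τ} :=
    Finset.filter_congr fun z _ => by rw [ne_eq, sub_eq_zero]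
  obtain ⟨X₂, hX₂, Y₂, hY₂, hXc, hYc, hzero⟩ :=
    ((h'.mono hX₁ hY₁).of_le hlam).exists_zero_rectangle (by positivity)
      (by rw [hset]; refine le_trans (le_of_eq ?_) hsp; ring)
  refine ⟨X₂, hX₂.trans hX₁, Y₂, hY₂.trans hY₁,
    fun i hi j hj => sub_eq_zero.1 (hzero i hi j hj), hcard.trans ?_⟩
  calc 2 ^ (8 * (D * Q) * (lam + 2 + d + 1) + d + 1) * (X₁.card * Y₁.card)
      ≤ 2 ^ (8 * (D * Q) * (lam + 2 + d + 1) + d + 1) * ((2 * X₂.card) * (2 * Y₂.card)) := by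
        gcongr
    _ = _ := by ring

/-- A low-rank matrix with values in `{lo, …, lo + w}` is constant on a large rectangle. -/
theorem exists_constant_rectangle_of_range {f : A → B → ℕ} {D Q lam : ℕ}
    (hD : 0 < D) (hQ : 0 < Q) (hr : k + 1 ≤ Q ^ 2) (hlam : k + 1 ≤ 2 ^ lam) (w : ℕ) :
    ∀ (lo : ℕ) (X : Finset A) (Y : Finset B), RankLE (fun i j => (f i j : ℝ)) X Y k →
      lo + w ≤ D → X.Nonempty → Y.Nonempty →
      (∀ i ∈ X, ∀ j ∈ Y, lo ≤ f i j ∧ f i j ≤ lo + w) →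
      ∃ X' ⊆ X, ∃ Y' ⊆ Y, (∃ c, ∀ i ∈ X', ∀ j ∈ Y', f i j = c) ∧
        X.card * Y.card ≤
          2 ^ (8 * (D * Q) * (lam + (lam * D + 3) + 3) + (lam * D + 3) + 3 + 2 * w) *
            (X'.card * Y'.card) := by
  induction w using Nat.strong_induction_on with
  | _ w ih =>
  intro lo X Y h hwD hX hY hf
  set d := lam * D + 3 with hd
  set e := 8 * (D * Q) * (lam + d + 3) + d + 3 with he
  have hgrow : ∀ a : ℕ, 2 ^ e * a ≤ 2 ^ (e + 2 * w) * a := fun a =>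
    Nat.mul_le_mul_right _ (Nat.pow_le_pow_right (by norm_num) (by omega))
  have hwD' : (lo : ℝ) + w ≤ D := by exact_mod_cast hwD
  have hfR : ∀ i ∈ X, ∀ j ∈ Y, (lo : ℝ) ≤ f i j ∧ (f i j : ℝ) ≤ lo + w := fun i hi j hj =>
    ⟨by exact_mod_cast (hf i hi j hj).1, by exact_mod_cast (hf i hi j hj).2⟩
  by_cases htop : X.card * Y.card ≤ 2 ^ d * {z ∈ X ×ˢ Y | (f z.1 z.2 : ℝ) = lo + w}.card
  · obtain ⟨X', hX', Y', hY', hc, hcard⟩ := (h.of_le k.le_succ).exists_top_rectangle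
      (τ := lo + w) (D := D) (Q := Q) (lam := lam)
      ((h.affine 1 (-(lo + w))).congr fun i _ j _ => by ring) hD hQ hr hlam
      (fun i hi j hj => ⟨by positivity, (hfR i hi j hj).2.trans hwD'⟩)
      ⟨by positivity, hwD'⟩
      (fun i hi j hj => by
        rcases (hf i hi j hj).2.eq_or_lt with h1 | h1
        · left
          exact_mod_cast h1
        · right
          rw [le_sub_iff_add_le]
          exact_mod_cast h1) htop
    exact ⟨X', hX', Y', hY', ⟨lo + w, fun i hi j hj => by exact_mod_cast hc i hi j hj⟩,
      hcard.trans (hgrow _)⟩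
  by_cases hbot : X.card * Y.card ≤ 2 ^ d * {z ∈ X ×ˢ Y | (D : ℝ) - f z.1 z.2 = D - lo}.card
  -- Reflecting to `D - f` turns the smallest value into the largest.
  · have hlo : (0 : ℝ) ≤ lo := by positivity
    have hw0 : (0 : ℝ) ≤ w := by positivity
    obtain ⟨X', hX', Y', hY', hc, hcard⟩ :=
      RankLE.exists_top_rectangle (N := fun i j => (D : ℝ) - f i j) (τ := D - lo) (D := D) (Q := Q)
      (lam := lam) ((h.affine (-1) D).congr fun i _ j _ => by ring)
      ((h.affine (-1) lo).congr fun i _ j _ => by ring) hD hQ hr hlam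
      (fun i hi j hj => ⟨by linarith [(hfR i hi j hj).2], by linarith [(hfR i hi j hj).1]⟩)
      ⟨by linarith, by linarith⟩
      (fun i hi j hj => by
        rcases (hf i hi j hj).1.eq_or_lt with h1 | h1
        · left
          rw [h1]
        · right
          have : (lo : ℝ) + 1 ≤ f i j := by exact_mod_cast h1
          linarith) hbot
    refine ⟨X', hX', Y', hY', ⟨lo, fun i hi j hj => ?_⟩, hcard.trans (hgrow _)⟩
    have := hc i hi j hj
    have : (f i j : ℝ) = lo := by linarith
    exact_mod_cast this
  have hP := h.prod_sub (Finset.Ioo lo (lo + w))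
  have hcardle : (k + 1) ^ (Finset.Ioo lo (lo + w)).card ≤ 2 ^ (lam * D) := by
    rw [pow_mul, Nat.card_Ioo]
    calc (k + 1) ^ (lo + w - lo - 1) ≤ (k + 1) ^ D := Nat.pow_le_pow_right (by omega) (by omega)
      _ ≤ _ := Nat.pow_le_pow_left hlam _
  have hin : ∀ i ∈ X, ∀ j ∈ Y, ∏ c ∈ Finset.Ioo lo (lo + w), ((f i j : ℝ) - c) ≠ 0 →
      (f i j : ℝ) = lo + w ∨ (D : ℝ) - f i j = D - lo := by
    intro i hi j hj hne
    by_contra! hcon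
    refine hne (Finset.prod_eq_zero (i := f i j) ?_ (sub_self _))
    have h1 : f i j ≠ lo + w := fun h1 => hcon.1 (by exact_mod_cast h1)
    have h2 : f i j ≠ lo := fun h2 => hcon.2 (by rw [h2])
    have := hf i hi j hj
    exact Finset.mem_Ioo.2 ⟨by omega, by omega⟩
  have hsparse : 4 * 2 ^ (lam * D) * {z ∈ X ×ˢ Y |
      ∏ c ∈ Finset.Ioo lo (lo + w), ((f z.1 z.2 : ℝ) - c) ≠ 0}.card ≤ X.card * Y.card := by
    have h1 : {z ∈ X ×ˢ Y | ∏ c ∈ Finset.Ioo lo (lo + w), ((f z.1 z.2 : ℝ) - c) ≠ 0}.card ≤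
        {z ∈ X ×ˢ Y | (f z.1 z.2 : ℝ) = lo + w}.card +
          {z ∈ X ×ˢ Y | (D : ℝ) - f z.1 z.2 = D - lo}.card := by
      classical
      refine le_trans (Finset.card_le_card ?_) (Finset.card_union_le _ _)
      intro z hz
      obtain ⟨hz, hne⟩ := Finset.mem_filter.1 hz
      obtain ⟨hi, hj⟩ := Finset.mem_product.1 hz
      rw [Finset.mem_union, Finset.mem_filter, Finset.mem_filter]
      exact (hin _ hi _ hj hne).imp (fun h => ⟨hz, h⟩) (fun h => ⟨hz, h⟩)
    have h2 : 2 ^ d = 8 * 2 ^ (lam * D) := by rw [hd, pow_add]; ring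
    rw [h2] at htop hbot
    push Not at htop hbot
    have h3 := Nat.mul_le_mul_left (4 * 2 ^ (lam * D)) h1
    linarith
  obtain ⟨X₁, hX₁, Y₁, hY₁, hXc, hYc, hzero⟩ :=
    (hP.of_le hcardle).exists_zero_rectangle (by positivity) hsparse
  have hX₁n : X₁.Nonempty := Finset.card_pos.1 (by have := hX.card_pos; omega)
  have hY₁n : Y₁.Nonempty := Finset.card_pos.1 (by have := hY.card_pos; omega)
  have hin₁ : ∀ i ∈ X₁, ∀ j ∈ Y₁, lo < f i j ∧ f i j < lo + w := by
    intro i hi j hj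
    obtain ⟨c, hc, hc0⟩ := Finset.prod_eq_zero_iff.1 (hzero i hi j hj)
    have : f i j = c := by exact_mod_cast sub_eq_zero.1 hc0
    rw [this]
    exact Finset.mem_Ioo.1 hc
  -- A value strictly between the extremes exists, so `w - 2` below is not truncated.
  have hw2 : 2 ≤ w := by
    obtain ⟨i, hi⟩ := hX₁n
    obtain ⟨j, hj⟩ := hY₁n
    have := hin₁ i hi j hj
    omega
  obtain ⟨X', hX', Y', hY', hc, hcard⟩ := ih (w - 2) (by omega) (lo + 1) X₁ Y₁ (h.mono hX₁ hY₁)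
    (by omega) hX₁n hY₁n (fun i hi j hj => by have := hin₁ i hi j hj; omega)
  refine ⟨X', hX'.trans hX₁, Y', hY'.trans hY₁, hc, ?_⟩
  calc X.card * Y.card ≤ (2 * X₁.card) * (2 * Y₁.card) := Nat.mul_le_mul hXc hYc
    _ = 4 * (X₁.card * Y₁.card) := by ring
    _ ≤ 4 * (2 ^ (e + 2 * (w - 2)) * (X'.card * Y'.card)) := Nat.mul_le_mul_left _ hcard
    _ = 2 ^ (e + 2 * (w - 2) + 2) * (X'.card * Y'.card) := by ring
    _ ≤ _ := Nat.mul_le_mul_right _ (Nat.pow_le_pow_right (by norm_num) (by omega))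

end RankLE

/-! ### Building protocols. -/

namespace CommProtocol

variable {A B A₁ B₁ Z : Type*}

/-- Exchange the roles of Alice and Bob. -/
def swap : CommProtocol A B Z → CommProtocol B A Z
  | output z => output z
  | alice msg p₀ p₁ => bob msg p₀.swap p₁.swap
  | bob msg p₀ p₁ => alice msg p₀.swap p₁.swap

theorem run_swap (p : CommProtocol A B Z) (a : A) (b : B) : p.swap.run b a = p.run a b := by
  induction p with
  | output z => rfl
  | alice msg p₀ p₁ h₀ h₁ => simp only [swap, run, h₀, h₁]
  | bob msg p₀ p₁ h₀ h₁ => simp only [swap, run, h₀, h₁]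

theorem bits_swap (p : CommProtocol A B Z) (a : A) (b : B) : p.swap.bits b a = p.bits a b := by
  induction p with
  | output z => rfl
  | alice msg p₀ p₁ h₀ h₁ => simp only [swap, bits, h₀, h₁]
  | bob msg p₀ p₁ h₀ h₁ => simp only [swap, bits, h₀, h₁]

/-- Both players apply a map to their input before they run the protocol. -/
def comap (φ : A₁ → A) (ψ : B₁ → B) : CommProtocol A B Z → CommProtocol A₁ B₁ Z
  | output z => output z
  | alice msg p₀ p₁ => alice (msg ∘ φ) (p₀.comap φ ψ) (p₁.comap φ ψ)
  | bob msg p₀ p₁ => bob (msg ∘ ψ) (p₀.comap φ ψ) (p₁.comap φ ψ)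

theorem run_comap (φ : A₁ → A) (ψ : B₁ → B) (p : CommProtocol A B Z) (a : A₁) (b : B₁) :
    (p.comap φ ψ).run a b = p.run (φ a) (ψ b) := by
  induction p with
  | output z => rfl
  | alice msg p₀ p₁ h₀ h₁ => simp only [comap, run, h₀, h₁, Function.comp]
  | bob msg p₀ p₁ h₀ h₁ => simp only [comap, run, h₀, h₁, Function.comp]

theorem bits_comap (φ : A₁ → A) (ψ : B₁ → B) (p : CommProtocol A B Z) (a : A₁) (b : B₁) :
    (p.comap φ ψ).bits a b = p.bits (φ a) (ψ b) := by
  induction p with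
  | output z => rfl
  | alice msg p₀ p₁ h₀ h₁ => simp only [comap, bits, h₀, h₁, Function.comp]
  | bob msg p₀ p₁ h₀ h₁ => simp only [comap, bits, h₀, h₁, Function.comp]

end CommProtocol

theorem Finset.exists_injOn_lt_card {α : Type*} (s : Finset α) :
    ∃ t : α → ℕ, Set.InjOn t s ∧ ∀ a ∈ s, t a < s.card := by
  classical
  refine ⟨fun a => if ha : a ∈ s then s.equivFin ⟨a, ha⟩ else 0, ?_, ?_⟩
  · intro a ha b hb hab
    rw [Finset.mem_coe] at ha hb
    simpa [ha, hb, Fin.val_inj] using hab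
  · intro a ha
    simp [ha]

/-- Some protocol computes `f` on the rectangle `X × Y` with at most `c` bits. -/
def SolvableOn {A B Z : Type*} (f : A → B → Z) (X : Finset A) (Y : Finset B) (c : ℕ) : Prop :=
  ∃ p : CommProtocol A B Z, ∀ a ∈ X, ∀ b ∈ Y, p.run a b = f a b ∧ p.bits a b ≤ c

namespace SolvableOn

variable {A B Z : Type*} {f : A → B → Z} {X X' : Finset A} {Y Y' : Finset B} {c : ℕ}

theorem of_const {z : Z} (h : ∀ a ∈ X, ∀ b ∈ Y, f a b = z) : SolvableOn f X Y 0 :=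
  ⟨.output z, fun a ha b hb => ⟨(h a ha b hb).symm, le_rfl⟩⟩

theorem transpose (h : SolvableOn f X Y c) : SolvableOn (fun b a => f a b) Y X c := by
  obtain ⟨p, hp⟩ := h
  refine ⟨p.swap, fun b hb a ha => ?_⟩
  rw [p.run_swap, p.bits_swap]
  exact hp a ha b hb

theorem of_retract (h : SolvableOn f X' Y' c) (ρ : A → A) (σ : B → B)
    (hρ : ∀ a ∈ X, ρ a ∈ X') (hσ : ∀ b ∈ Y, σ b ∈ Y')
    (hf : ∀ a ∈ X, ∀ b ∈ Y, f (ρ a) (σ b) = f a b) : SolvableOn f X Y c := by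
  obtain ⟨p, hp⟩ := h
  refine ⟨p.comap ρ σ, fun a ha b hb => ?_⟩
  rw [p.run_comap, p.bits_comap, ← hf a ha b hb]
  exact hp _ (hρ a ha) _ (hσ b hb)

theorem alice_bit (P : A → Prop) [DecidablePred P] (h₁ : SolvableOn f {a ∈ X | P a} Y c)
    (h₀ : SolvableOn f {a ∈ X | ¬ P a} Y c) : SolvableOn f X Y (c + 1) := by
  obtain ⟨p₁, hp₁⟩ := h₁
  obtain ⟨p₀, hp₀⟩ := h₀
  refine ⟨.alice (fun a => decide (P a)) p₀ p₁, fun a ha b hb => ?_⟩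
  by_cases hP : P a
  · have := hp₁ a (Finset.mem_filter.2 ⟨ha, hP⟩) b hb
    simpa [CommProtocol.run, CommProtocol.bits, hP] using this
  · have := hp₀ a (Finset.mem_filter.2 ⟨ha, hP⟩) b hb
    simpa [CommProtocol.run, CommProtocol.bits, hP] using this

/-- Alice announces a number below `2 ^ m` that she computes from her input. -/
theorem alice_send (m : ℕ) : ∀ (X : Finset A) (t : A → ℕ), (∀ a ∈ X, t a < 2 ^ m) →
    (∀ n, SolvableOn f {a ∈ X | t a = n} Y c) → SolvableOn f X Y (c + m) := by
  induction m with
  | zero =>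
    intro X t ht h
    have : {a ∈ X | t a = 0} = X := Finset.filter_true_of_mem fun a ha => by
      have := ht a ha
      omega
    simpa [this] using h 0
  | succ m ih =>
    intro X t ht h
    -- The leading binary digit is sent first; the remainder is sent recursively.
    refine alice_bit (fun a => t a < 2 ^ m) (ih _ t (fun a ha => (Finset.mem_filter.1 ha).2) ?_)
      (ih _ (fun a => t a - 2 ^ m) (fun a ha => ?_) ?_)
    · intro n
      obtain ⟨p, hp⟩ := h n
      refine ⟨p, fun a ha => hp a ?_⟩
      simp only [Finset.mem_filter] at ha ⊢
      exact ⟨ha.1.1, ha.2⟩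
    · obtain ⟨haX, -⟩ := Finset.mem_filter.1 ha
      have := ht a haX
      rw [pow_succ] at this
      have : 0 < 2 ^ m := by positivity
      omega
    · intro n
      obtain ⟨p, hp⟩ := h (n + 2 ^ m)
      refine ⟨p, fun a ha => hp a ?_⟩
      simp only [Finset.mem_filter] at ha ⊢
      exact ⟨ha.1.1, by omega⟩

theorem bob_send (m : ℕ) (t : B → ℕ) (ht : ∀ b ∈ Y, t b < 2 ^ m)
    (h : ∀ n, SolvableOn f X {b ∈ Y | t b = n} c) : SolvableOn f X Y (c + m) :=
  (alice_send m Y t ht fun n => (h n).transpose).transpose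

theorem both_send {m n : ℕ} (s : A → ℕ) (t : B → ℕ) (hs : ∀ a ∈ X, s a < 2 ^ m)
    (ht : ∀ b ∈ Y, t b < 2 ^ n)
    (h : ∀ i j, SolvableOn f {a ∈ X | s a = i} {b ∈ Y | t b = j} c) :
    SolvableOn f X Y (c + n + m) :=
  alice_send m X s hs fun i => bob_send n t ht (h i)

theorem of_card [Nonempty Z] {m n : ℕ} (hX : X.card ≤ 2 ^ m) (hY : Y.card ≤ 2 ^ n) :
    SolvableOn f X Y (n + m) := by
  obtain ⟨s, hs, hs'⟩ := X.exists_injOn_lt_card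
  obtain ⟨t, ht, ht'⟩ := Y.exists_injOn_lt_card
  rw [show n + m = 0 + n + m by ring]
  refine both_send s t (fun a ha => (hs' a ha).trans_le hX) (fun b hb => (ht' b hb).trans_le hY) ?_
  intro i j
  by_cases hne : ∃ a ∈ X, ∃ b ∈ Y, s a = i ∧ t b = j
  · obtain ⟨a, ha, b, hb, rfl, rfl⟩ := hne
    refine of_const (z := f a b) fun a' ha' b' hb' => ?_
    obtain ⟨ha', hsa⟩ := Finset.mem_filter.1 ha'
    obtain ⟨hb', htb⟩ := Finset.mem_filter.1 hb'
    rw [hs ha' ha hsa, ht hb' hb htb]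
  · push Not at hne
    refine of_const (z := Classical.arbitrary Z) fun a ha b hb => ?_
    obtain ⟨ha, hsa⟩ := Finset.mem_filter.1 ha
    obtain ⟨hb, htb⟩ := Finset.mem_filter.1 hb
    exact absurd htb (hne a ha b hb hsa)

end SolvableOn

/-! ### Grid decompositions of a rectangle. -/

section Partition

variable {A B : Type*}

/-- Repeatedly splitting off a `1 / q` fraction of the rows or of the columns decomposes `X × Y`
into a grid of good rectangles. -/
theorem exists_partition {good : Finset A → Finset B → Prop} {q : ℕ} {X₀ : Finset A}
    {Y₀ : Finset B} (hmono : ∀ X X' Y Y', X' ⊆ X → Y' ⊆ Y → good X Y → good X' Y')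
    (hempty : ∀ X Y, X = ∅ ∨ Y = ∅ → good X Y)
    (hstep : ∀ X ⊆ X₀, ∀ Y ⊆ Y₀, X.Nonempty → Y.Nonempty →
      (∃ X' ⊆ X, good X' Y ∧ X.card ≤ q * X'.card) ∨
        ∃ Y' ⊆ Y, good X Y' ∧ Y.card ≤ q * Y'.card) (n : ℕ) :
    ∀ X ⊆ X₀, ∀ Y ⊆ Y₀, X.card * Y.card * (q - 1) ^ n < q ^ n →
      ∃ (s : A → ℕ) (t : B → ℕ), (∀ a ∈ X, s a ≤ n) ∧ (∀ b ∈ Y, t b ≤ n) ∧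
        ∀ i j, good {a ∈ X | s a = i} {b ∈ Y | t b = j} := by
  classical
  induction n with
  | zero =>
    intro X _ Y _ h
    have h0 : X.card * Y.card = 0 := by simpa using h
    refine ⟨fun _ => 0, fun _ => 0, by simp, by simp, fun i j => hempty _ _ ?_⟩
    rcases Nat.mul_eq_zero.1 h0 with h0 | h0
    · left
      simp [Finset.card_eq_zero.1 h0]
    · right
      simp [Finset.card_eq_zero.1 h0]
  | succ n ih =>
    intro X hX Y hY h
    rcases X.eq_empty_or_nonempty with rfl | hXn
    · exact ⟨fun _ => 0, fun _ => 0, by simp, by simp, fun i j => hempty _ _ (.inl (by simp))⟩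
    rcases Y.eq_empty_or_nonempty with rfl | hYn
    · exact ⟨fun _ => 0, fun _ => 0, by simp, by simp, fun i j => hempty _ _ (.inr (by simp))⟩
    have shrink : ∀ a a' b : ℕ, a' ≤ a → a ≤ q * a' → a * b * (q - 1) ^ (n + 1) < q ^ (n + 1) →
        (a - a') * b * (q - 1) ^ n < q ^ n := by
      intro a a' b ha' haq hlt
      have hq : 0 < q := by
        rcases Nat.eq_zero_or_pos q with rfl | hq
        · simp at hlt
        · exact hq
      have h1 : (a - a') * q ≤ a * (q - 1) := by
        rw [Nat.sub_mul, Nat.mul_sub, mul_one, mul_comm a' q]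
        omega
      refine lt_of_mul_lt_mul_left (a := q) ?_ (Nat.zero_le _)
      calc q * ((a - a') * b * (q - 1) ^ n) = (a - a') * q * (b * (q - 1) ^ n) := by ring
        _ ≤ a * (q - 1) * (b * (q - 1) ^ n) := Nat.mul_le_mul_right _ h1
        _ = a * b * (q - 1) ^ (n + 1) := by ring
        _ < q ^ (n + 1) := hlt
        _ = q * q ^ n := by ring
    rcases hstep X hX Y hY hXn hYn with ⟨X', hX', hgood, hcard⟩ | ⟨Y', hY', hgood, hcard⟩
    · obtain ⟨s, t, hs, ht, hst⟩ := ih (X \ X') (Finset.sdiff_subset.trans hX) Y hY (by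
        rw [Finset.card_sdiff_of_subset hX']
        exact shrink _ _ _ (Finset.card_le_card hX') hcard h)
      -- Row index `0` is reserved for the new piece, which is good against all columns. The other
      -- indices shift by one on both sides, so column index `0` stays empty and the old grid is
      -- reproduced.
      refine ⟨fun a => if a ∈ X' then 0 else s a + 1, fun b => t b + 1, ?_, ?_, ?_⟩
      · intro a ha
        dsimp only
        split_ifs with haX
        · omega
        · exact Nat.succ_le_succ (hs a (Finset.mem_sdiff.2 ⟨ha, haX⟩))
      · exact fun b hb => Nat.succ_le_succ (ht b hb)
      · intro i j
        rcases i with _ | i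
        · refine hmono _ _ _ _ (fun a ha => ?_) (Finset.filter_subset _ _) hgood
          by_contra haX
          simp [haX] at ha
        · rcases j with _ | j
          · exact hempty _ _ (.inr (by simp))
          · refine hmono _ _ _ _ (fun a ha => ?_) (fun b hb => ?_) (hst i j)
            · obtain ⟨haX, ha⟩ := Finset.mem_filter.1 ha
              dsimp only at ha
              split_ifs at ha with haX'
              exact Finset.mem_filter.2 ⟨Finset.mem_sdiff.2 ⟨haX, haX'⟩, Nat.succ_injective ha⟩
            · obtain ⟨hbY, hb⟩ := Finset.mem_filter.1 hb
              exact Finset.mem_filter.2 ⟨hbY, Nat.succ_injective hb⟩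
    · obtain ⟨s, t, hs, ht, hst⟩ := ih X hX (Y \ Y') (Finset.sdiff_subset.trans hY) (by
        rw [Finset.card_sdiff_of_subset hY', mul_comm X.card]
        rw [mul_comm X.card] at h
        exact shrink _ _ _ (Finset.card_le_card hY') hcard h)
      refine ⟨fun a => s a + 1, fun b => if b ∈ Y' then 0 else t b + 1, ?_, ?_, ?_⟩
      · exact fun a ha => Nat.succ_le_succ (hs a ha)
      · intro b hb
        dsimp only
        split_ifs with hbY
        · omega
        · exact Nat.succ_le_succ (ht b (Finset.mem_sdiff.2 ⟨hb, hbY⟩))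
      · intro i j
        rcases j with _ | j
        · refine hmono _ _ _ _ (Finset.filter_subset _ _) (fun b hb => ?_) hgood
          by_contra hbY
          simp [hbY] at hb
        · rcases i with _ | i
          · exact hempty _ _ (.inl (by simp))
          · refine hmono _ _ _ _ (fun a ha => ?_) (fun b hb => ?_) (hst i j)
            · obtain ⟨haX, ha⟩ := Finset.mem_filter.1 ha
              exact Finset.mem_filter.2 ⟨haX, Nat.succ_injective ha⟩
            · obtain ⟨hbY, hb⟩ := Finset.mem_filter.1 hb
              dsimp only at hb
              split_ifs at hb with hbY'
              exact Finset.mem_filter.2 ⟨Finset.mem_sdiff.2 ⟨hbY, hbY'⟩, Nat.succ_injective hb⟩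

/-- With `p = q - 1 > 0`, Bernoulli gives `(1 + 1 / p) ^ (p + 1) > 2`. Thus `q` removals of a `1 /
q` fraction halve the area. -/
theorem two_mul_pred_pow_lt {q : ℕ} (hq : 0 < q) : 2 * (q - 1) ^ q < q ^ q := by
  obtain ⟨p, rfl⟩ := Nat.exists_eq_add_of_lt hq
  simp only [zero_add, Nat.add_sub_cancel]
  rcases Nat.eq_zero_or_pos p with rfl | hp
  · simp
  have hp' : (0 : ℝ) < p := by exact_mod_cast hp
  have hp0 : 0 < 1 / (p : ℝ) := by positivity
  have h := one_add_mul_le_pow (a := 1 / (p : ℝ)) (by linarith) (p + 1)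
  have h2 : (2 : ℝ) < 1 + (p + 1 : ℕ) * (1 / (p : ℝ)) := by
    push_cast
    rw [add_mul, mul_one_div_cancel hp'.ne', one_mul]
    linarith
  have h3 : (2 : ℝ) * p ^ (p + 1) < (p + 1) ^ (p + 1) := by
    calc (2 : ℝ) * p ^ (p + 1) < (1 + 1 / (p : ℝ)) ^ (p + 1) * p ^ (p + 1) :=
          mul_lt_mul_of_pos_right (h2.trans_le h) (by positivity)
      _ = _ := by
        rw [← mul_pow]
        congr 1
        field_simp
  exact_mod_cast h3

theorem card_mul_pred_pow_lt {q g a : ℕ} (hq : 0 < q) (hg : 0 < g) (ha : a ≤ 2 ^ g) :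
    a * (q - 1) ^ (q * g) < q ^ (q * g) := by
  calc a * (q - 1) ^ (q * g) ≤ 2 ^ g * (q - 1) ^ (q * g) := Nat.mul_le_mul_right _ ha
    _ = (2 * (q - 1) ^ q) ^ g := by rw [mul_pow, pow_mul]
    _ < (q ^ q) ^ g := Nat.pow_lt_pow_left (two_mul_pred_pow_lt hq) hg.ne'
    _ = _ := by rw [pow_mul]

end Partition

/-! ### The rank-halving protocol. -/

section LowRank

variable {A B : Type*} {Δ : ℕ} {f : A → B → Fin (Δ + 1)} {X : Finset A} {Y : Finset B} {k : ℕ}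

/-- A column is determined by its entries in at most `k` generating rows, so there are few distinct
columns; one representative of each is kept. -/
theorem RankLE.exists_column_retract (h : RankLE (fun i j => ((f i j : ℕ) : ℝ)) X Y k) :
    ∃ Y' ⊆ Y, Y'.card ≤ (Δ + 1) ^ k ∧
      ∃ σ : B → B, ∀ b ∈ Y, σ b ∈ Y' ∧ ∀ a ∈ X, f a (σ b) = f a b := by
  classical
  rcases Y.eq_empty_or_nonempty with rfl | ⟨b₀, hb₀⟩
  · exact ⟨∅, subset_rfl, by simp, id, by simp⟩
  have : Nonempty B := ⟨b₀⟩
  obtain ⟨I, hI, hIc, hrows⟩ := h.exists_rows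
  let key : B → I → Fin (Δ + 1) := fun b i => f i b
  have hrep : ∀ b ∈ Y, Function.invFunOn key Y (key b) ∈ (Y : Set B) ∧
      key (Function.invFunOn key Y (key b)) = key b := fun b hb =>
    Function.invFunOn_pos ⟨b, hb, rfl⟩
  refine ⟨Y.image fun b => Function.invFunOn key Y (key b), ?_, ?_,
    fun b => Function.invFunOn key Y (key b), fun b hb => ⟨Finset.mem_image_of_mem _ hb, ?_⟩⟩
  · intro y hy
    obtain ⟨b, hb, rfl⟩ := Finset.mem_image.1 hy
    exact (hrep b hb).1
  · calc (Y.image fun b => Function.invFunOn key Y (key b)).card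
        = ((Y.image key).image (Function.invFunOn key Y)).card := by
          rw [Finset.image_image]; rfl
      _ ≤ (Y.image key).card := Finset.card_image_le
      _ ≤ Fintype.card (I → Fin (Δ + 1)) := Finset.card_le_univ _
      _ = (Δ + 1) ^ I.card := by simp
      _ ≤ _ := Nat.pow_le_pow_right (Nat.succ_pos _) hIc
  · intro a ha
    obtain ⟨c, hc⟩ := hrows a ha
    have heq : ((f a (Function.invFunOn key Y (key b)) : ℕ) : ℝ) = (f a b : ℕ) := by
      rw [hc _ (hrep b hb).1, hc b hb]
      refine Finset.sum_congr rfl fun i hi => ?_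
      have := congrFun (hrep b hb).2 ⟨i, hi⟩
      simp only [key] at this
      rw [this]
    exact Fin.ext (by exact_mod_cast heq)

theorem RankLE.solvableOn_of_small (h : RankLE (fun i j => ((f i j : ℕ) : ℝ)) X Y k) {c : ℕ}
    (hsolve : ∀ X' ⊆ X, ∀ Y' ⊆ Y, X'.card ≤ (Δ + 1) ^ k → Y'.card ≤ (Δ + 1) ^ k →
      SolvableOn f X' Y' c) : SolvableOn f X Y c := by
  obtain ⟨Y', hY', hYc, σ, hσ⟩ := h.exists_column_retract
  obtain ⟨X', hX', hXc, ρ, hρ⟩ :=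
    RankLE.exists_column_retract (f := fun b a => f a b) h.transpose
  refine (hsolve X' hX' Y' hY' hXc hYc).of_retract ρ σ (fun a ha => (hρ a ha).1)
    (fun b hb => (hσ b hb).1) fun a ha b hb => ?_
  rw [(hρ a ha).2 _ (hY' (hσ b hb).1), (hσ b hb).2 a ha]

theorem RankLE.solvableOn (h : RankLE (fun i j => ((f i j : ℕ) : ℝ)) X Y k) :
    SolvableOn f X Y (2 * (Δ * k)) := by
  refine h.solvableOn_of_small fun X' _ Y' _ hX hY => ?_
  have hle : (Δ + 1) ^ k ≤ 2 ^ (Δ * k) := by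
    rw [pow_mul]
    exact Nat.pow_le_pow_left Nat.lt_two_pow_self _
  rw [two_mul]
  exact SolvableOn.of_card (hX.trans hle) (hY.trans hle)

/-- On the rows or on the columns of a constant rectangle, the rank drops by half. -/
theorem RankLE.half_of_constant {M : A → B → ℝ} {X' : Finset A} {Y' : Finset B}
    (h : RankLE M X Y k) (hX : X' ⊆ X) (hY : Y' ⊆ Y) {c : ℝ}
    (hc : ∀ i ∈ X', ∀ j ∈ Y', M i j = c) :
    RankLE M X' Y ((k + 1) / 2 + 1) ∨ RankLE M X Y' ((k + 1) / 2 + 1) := by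
  -- Subtracting `c` costs one in rank, the smaller of the two parts has rank at most `(k + 1) / 2`,
  -- and adding `c` back costs one more.
  obtain ⟨k₁, k₂, hk, h₁, h₂⟩ := (h.affine 1 (-c)).split_of_zero hX hY
    (fun i hi j hj => by rw [hc i hi j hj]; ring)
  rcases le_total k₁ k₂ with hle | hle
  · left
    exact ((h₁.affine 1 c).congr fun i _ j _ => by ring).of_le (by omega)
  · right
    exact ((h₂.affine 1 c).congr fun i _ j _ => by ring).of_le (by omega)

/-- One round of the protocol: the players agree on a rectangle of half the rank. -/
theorem RankLE.solvableOn_of_half (hΔ : 0 < Δ) (hk : 0 < k)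
    (h : RankLE (fun i j => ((f i j : ℕ) : ℝ)) X Y k) {lam c : ℕ} (hlam0 : 0 < lam)
    (hlam : k + 1 ≤ 2 ^ lam)
    (hsolve : ∀ (X' : Finset A) (Y' : Finset B),
      RankLE (fun i j => ((f i j : ℕ) : ℝ)) X' Y' ((k + 1) / 2 + 1) → SolvableOn f X' Y' c) :
    SolvableOn f X Y (c + 152 * (Δ ^ 2 * lam * (Nat.sqrt k + 1))) := by
  set Q := Nat.sqrt k + 1 with hQ
  set e := 8 * (Δ * Q) * (lam + (lam * Δ + 3) + 3) + (lam * Δ + 3) + 3 + 2 * Δ with he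
  set g := 2 * (Δ * k) with hg
  have hQ2 : k + 1 ≤ Q ^ 2 := by
    have := Nat.lt_succ_sqrt k
    rw [hQ, sq]
    exact this
  have hmulpos : 0 < Δ * k := Nat.mul_pos hΔ hk
  refine h.solvableOn_of_small fun X₀ hX₀ Y₀ hY₀ hXc hYc => ?_
  have hle : (Δ + 1) ^ k ≤ 2 ^ (Δ * k) := by
    rw [pow_mul]
    exact Nat.pow_le_pow_left Nat.lt_two_pow_self _
  have harea : X₀.card * Y₀.card ≤ 2 ^ g := by
    rw [hg, two_mul, pow_add]
    exact Nat.mul_le_mul (hXc.trans hle) (hYc.trans hle)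
  have hstep : ∀ X₁ ⊆ X₀, ∀ Y₁ ⊆ Y₀, X₁.Nonempty → Y₁.Nonempty →
      (∃ X' ⊆ X₁, RankLE (fun i j => ((f i j : ℕ) : ℝ)) X' Y₁ ((k + 1) / 2 + 1) ∧
        X₁.card ≤ 2 ^ e * X'.card) ∨
      ∃ Y' ⊆ Y₁, RankLE (fun i j => ((f i j : ℕ) : ℝ)) X₁ Y' ((k + 1) / 2 + 1) ∧
        Y₁.card ≤ 2 ^ e * Y'.card := by
    intro X₁ hX₁ Y₁ hY₁ hXn hYn
    have h₁ := h.mono (hX₁.trans hX₀) (hY₁.trans hY₀)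
    obtain ⟨X', hX', Y', hY', ⟨v, hv⟩, hcard⟩ := RankLE.exists_constant_rectangle_of_range
      (f := fun i j => (f i j : ℕ)) hΔ (Nat.succ_pos _) hQ2 hlam Δ 0 X₁ Y₁ h₁ (by omega) hXn hYn
      (fun i _ j _ => ⟨Nat.zero_le _, by have := (f i j).2; omega⟩)
    rcases h₁.half_of_constant hX' hY' (c := v)
      (fun i hi j hj => by exact_mod_cast hv i hi j hj) with hr | hr
    · refine .inl ⟨X', hX', hr, Nat.le_of_mul_le_mul_right ?_ hYn.card_pos⟩
      calc _ ≤ _ := hcard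
        _ ≤ 2 ^ e * (X'.card * Y₁.card) := by
          gcongr
        _ = _ := by ring
    · refine .inr ⟨Y', hY', hr, Nat.le_of_mul_le_mul_left ?_ hXn.card_pos⟩
      calc _ ≤ _ := hcard
        _ ≤ 2 ^ e * (X₁.card * Y'.card) := by
          gcongr
        _ = _ := by ring
  obtain ⟨s, t, hs, ht, hst⟩ := exists_partition
    (good := fun X' Y' => RankLE (fun i j => ((f i j : ℕ) : ℝ)) X' Y' ((k + 1) / 2 + 1))
    (fun _ _ _ _ hX hY h => h.mono hX hY)
    (fun X' Y' h => ⟨0, 0, by rcases h with rfl | rfl <;> simp⟩) hstep (2 ^ e * g)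
    X₀ subset_rfl Y₀ subset_rfl (card_mul_pred_pow_lt (by positivity) (by omega) harea)
  set m := e + (1 + lam + Δ) with hm
  have hn : 2 ^ e * g < 2 ^ m := by
    rw [hm, pow_add 2 e]
    refine (Nat.mul_lt_mul_left (by positivity)).2 ?_
    calc g = 2 * (k * Δ) := by rw [hg, mul_comm Δ]
      _ < 2 * (2 ^ lam * 2 ^ Δ) := by
        refine (Nat.mul_lt_mul_left (by norm_num)).2 ?_
        exact Nat.mul_lt_mul'' (by omega) Nat.lt_two_pow_self
      _ = _ := by rw [pow_add, pow_add, pow_one, mul_assoc]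
  obtain ⟨p, hp⟩ := SolvableOn.both_send (m := m) (n := m) s t
    (fun a ha => (hs a ha).trans_lt hn) (fun b hb => (ht b hb).trans_lt hn)
    fun i j => hsolve _ _ (hst i j)
  refine ⟨p, fun a ha b hb => ⟨(hp a ha b hb).1, (hp a ha b hb).2.trans ?_⟩⟩
  have hm' : m ≤ 76 * (Δ ^ 2 * lam * Q) := by
    have h1 : 1 ≤ lam * Δ := Nat.mul_pos hlam0 hΔ
    have h2 : lam ≤ lam * Δ := Nat.le_mul_of_pos_right _ hΔ
    have h3 : Δ ≤ lam * Δ := Nat.le_mul_of_pos_left _ hlam0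
    have h4 : 8 * (Δ * Q) * (lam + (lam * Δ + 3) + 3) ≤ 8 * (Δ * Q) * (8 * (lam * Δ)) :=
      Nat.mul_le_mul_left _ (by omega)
    have h5 : lam * Δ ≤ lam * Δ * (Δ * Q) :=
      Nat.le_mul_of_pos_right _ (Nat.mul_pos hΔ (Nat.succ_pos _))
    calc m ≤ 8 * (Δ * Q) * (8 * (lam * Δ)) + 12 * (lam * Δ) := by omega
      _ ≤ 8 * (Δ * Q) * (8 * (lam * Δ)) + 12 * (lam * Δ * (Δ * Q)) := by omega
      _ = _ := by ring
  omega

open Real in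
/-- Halving the rank until it is at most `3` costs `O(Δ ^ 2 * lam * √k)` bits in total. -/
theorem RankLE.exists_solvableOn (hΔ : 0 < Δ) {lam : ℕ} (hlam0 : 0 < lam) (k : ℕ) :
    ∀ (X : Finset A) (Y : Finset B), RankLE (fun i j => ((f i j : ℕ) : ℝ)) X Y k →
      k < 2 ^ lam → ∃ c : ℕ, SolvableOn f X Y c ∧ (c : ℝ) ≤ 4864 * (Δ ^ 2 * lam) * √k := by
  induction k using Nat.strong_induction_on with
  | _ k ih =>
  intro X Y h hlam
  have hΔ1 : (1 : ℝ) ≤ Δ := by exact_mod_cast hΔ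
  have hlam1 : (1 : ℝ) ≤ lam := by exact_mod_cast hlam0
  have hΔlam : (Δ : ℝ) ≤ Δ ^ 2 * lam := by nlinarith
  -- For `k ≤ 3` the map `k ↦ (k + 1) / 2 + 1` no longer decreases `k`, so the direct protocol takes
  -- over.
  rcases Nat.lt_or_ge k 4 with hk | hk
  · refine ⟨_, h.solvableOn, ?_⟩
    have hsq : (k : ℝ) ≤ 3 * √k := by
      have h3 : √(k : ℝ) ≤ 3 := by
        rw [Real.sqrt_le_left (by norm_num)]
        have : (k : ℝ) ≤ 3 := by exact_mod_cast Nat.le_of_lt_succ hk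
        linarith
      calc (k : ℝ) = √k * √k := (mul_self_sqrt (by positivity)).symm
        _ ≤ 3 * √k := by gcongr
    push_cast
    calc (2 : ℝ) * (Δ * k) ≤ 2 * ((Δ ^ 2 * lam) * (3 * √k)) := by gcongr
      _ = 6 * (Δ ^ 2 * lam) * √k := by ring
      _ ≤ _ := by gcongr; norm_num
  · set k' := (k + 1) / 2 + 1 with hk'
    have hlt : k' < k := by omega
    have hsolve : ∀ (X' : Finset A) (Y' : Finset B),
        RankLE (fun i j => ((f i j : ℕ) : ℝ)) X' Y' k' →
          SolvableOn f X' Y' ⌊4864 * (Δ ^ 2 * lam) * √(k' : ℝ)⌋₊ := by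
      intro X' Y' h'
      obtain ⟨c, ⟨p, hp⟩, hc⟩ := ih k' hlt X' Y' h' (hlt.trans hlam)
      exact ⟨p, fun a ha b hb => ⟨(hp a ha b hb).1, (hp a ha b hb).2.trans (Nat.le_floor hc)⟩⟩
    refine ⟨_, h.solvableOn_of_half hΔ (by omega) hlam0 hlam hsolve, ?_⟩
    have hkR : (4 : ℝ) ≤ k := by exact_mod_cast hk
    have hsqrt1 : 1 ≤ √(k : ℝ) := Real.one_le_sqrt.2 (by linarith)
    have hQ : (Nat.sqrt k : ℝ) + 1 ≤ 2 * √k := by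
      have := Real.nat_sqrt_le_real_sqrt (a := k)
      linarith
    -- For `k ≥ 4` one has `k' ≤ 7 / 8 * k`, and `7 / 8 ≤ (15 / 16) ^ 2`. The remaining `1 / 16` of
    -- `4864` is `304 = 152 * 2`, which pays for this round.
    have hk'le : √(k' : ℝ) ≤ 15 / 16 * √k := by
      rw [Real.sqrt_le_left (by positivity), mul_pow, Real.sq_sqrt (by positivity)]
      have h8 : 8 * k' ≤ 7 * k := by omega
      have h8R : (8 : ℝ) * k' ≤ 7 * k := by exact_mod_cast h8
      linarith
    have hfl := Nat.floor_le (show 0 ≤ 4864 * (Δ ^ 2 * lam) * √(k' : ℝ) by positivity)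
    push_cast
    calc (⌊4864 * (Δ ^ 2 * lam) * √(k' : ℝ)⌋₊ : ℝ) +
          152 * (Δ ^ 2 * lam * (Nat.sqrt k + 1))
        ≤ 4864 * (Δ ^ 2 * lam) * (15 / 16 * √k) + 152 * (Δ ^ 2 * lam * (2 * √k)) := by
          refine add_le_add (hfl.trans ?_) ?_ <;> gcongr
      _ = _ := by ring

end LowRank

/-! ### Passing to the natural logarithm, and the final bound. -/

theorem natLog_succ_le_log (r : ℕ) :
    ((Nat.log 2 r + 1 : ℕ) : ℝ) ≤ 4 * Real.log (max (r : ℝ) 2) := by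
  set L := Real.log (max (r : ℝ) 2) with hL
  have h2 : Real.log 2 ≤ L := Real.log_le_log (by norm_num) (le_max_right _ _)
  have hpow : (2 : ℝ) ^ Nat.log 2 r ≤ max (r : ℝ) 2 := by
    rcases Nat.eq_zero_or_pos r with rfl | hr
    · simp
    · refine le_trans ?_ (le_max_left _ _)
      exact_mod_cast Nat.pow_log_le_self 2 hr.ne'
  have hlog : Nat.log 2 r * Real.log 2 ≤ L := by
    rw [← Real.log_pow]
    exact Real.log_le_log (by positivity) hpow
  have := Real.log_two_gt_d9
  push_cast
  have hn : (0 : ℝ) ≤ Nat.log 2 r := by positivity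
  nlinarith

/-- There is an absolute constant `C` such that every `f : A × B → {0, 1, …, Δ}` of rank `r` is
computed by a deterministic protocol of length at most `C · Δ ^ (C Δ) · √r · log (max r 2)`. -/
theorem mainTheorem1 :
    ∃ C : ℕ, ∀ (Δ r : ℕ) (A : Type*) (B : Type*) [Fintype A] [Fintype B]
      (f : A × B → Fin (Δ + 1)), (valueMatrix f).rank = r →
        ∃ p : CommProtocol A B (Fin (Δ + 1)), p.Computes f ∧
          (p.length : ℝ) ≤ (C : ℝ) * (Δ : ℝ) ^ (C * Δ) * √(r : ℝ) * Real.log (max (r : ℝ) 2) := by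
  -- `19456 = 4864 * 4`: the constant of the protocol times the one from `natLog_succ_le_log`.
  refine ⟨19456, fun Δ r A B _ _ f hr => ?_⟩
  have hL0 : 0 ≤ Real.log (max (r : ℝ) 2) :=
    Real.log_nonneg (le_trans (by norm_num) (le_max_right _ _))
  rcases Nat.eq_zero_or_pos Δ with rfl | hΔ
  · refine ⟨.output 0, fun a b => Fin.ext (by omega), ?_⟩
    have : (CommProtocol.output 0 : CommProtocol A B (Fin (0 + 1))).length = 0 :=
      Nat.le_zero.1 (Finset.sup_le fun _ _ => le_rfl)
    rw [this]
    push_cast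
    positivity
  have hrank : RankLE (fun a b => ((f (a, b) : ℕ) : ℝ)) Finset.univ Finset.univ r :=
    hr ▸ RankLE.of_rank (valueMatrix f) Finset.univ Finset.univ
  obtain ⟨c, ⟨p, hp⟩, hc⟩ := RankLE.exists_solvableOn (f := fun a b => f (a, b)) hΔ
    (Nat.succ_pos (Nat.log 2 r)) r _ _ hrank (Nat.lt_pow_succ_log_self (by norm_num) r)
  refine ⟨p, fun a b => (hp a (Finset.mem_univ _) b (Finset.mem_univ _)).1, ?_⟩
  have hlen : p.length ≤ c :=
    Finset.sup_le fun x _ => (hp x.1 (Finset.mem_univ _) x.2 (Finset.mem_univ _)).2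
  have hΔ1 : (1 : ℝ) ≤ Δ := by exact_mod_cast hΔ
  have hpow : (Δ : ℝ) ^ 2 ≤ (Δ : ℝ) ^ (19456 * Δ) := pow_le_pow_right₀ hΔ1 (by omega)
  calc (p.length : ℝ) ≤ c := by exact_mod_cast hlen
    _ ≤ _ := hc
    _ ≤ 4864 * ((Δ : ℝ) ^ (19456 * Δ) * (4 * Real.log (max (r : ℝ) 2))) * √r := by
      gcongr
      exact natLog_succ_le_log r
    _ = _ := by
      push_cast
      ring
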